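/- Let $\Omega\subset\mathbb R^n$ be a bounded open set with $\partial\Omega=\Gamma_d\cup\Gamma_n$, and let $S\subset\mathbb R^n$ be a closed exceptional set with $\mathcal H^{n-1}(S)=0$ (possibly empty) such that $\partial\Omega$ is $C^1$, with $\Omega$ locally on one side and outer unit normal $\nu$, near every point of $\partial\Omega\setminus S$. Let $T>0$ and let $(u,\rho)$ be a smooth solution of the viscous Hughes system $$\rho_t-\operatorname{div}\big(\rho(1-\rho)^2Du\big)=\Delta\rho,\qquad |Du|^2=\frac1{(1-\rho)^2}\qquad\text{in }(\Omega\setminus S)\times(0,T),$$ with $\rho=u=0$ on $\Gamma_d\times(0,T)$ and $\rho_\nu=u_\nu=0$ on $(\Gamma_n\setminus S)\times(0,T)$. Here smooth means: $u,\rho$ are $C^2$ in $(\Omega\setminus S)\times(0,T)$ and $C^1$ in $(\overline\Omega\setminus S)\times(0,T)$; $\rho_t$, $D\rho$ and $Du$ are bounded in $(\Omega\setminus S)\times(0,T)$; and $\rho$ is continuous on $\overline\Omega\times[0,T]$. Suppose $0<\rho<1$ in $\Omega$ at $t=0$. Let $\alpha<-1$. Then $\rho<1$ in $\Omega\times[0,T]$,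 the integral $I(t)=\int_\Omega(1-\rho(x,t))^{\alpha+1}\,dx$ is finite for all $t\in[0,T]$ and differentiable on $(0,T)$, and $$\frac{d}{dt}\int_\Omega(1-\rho)^{\alpha+1}\,dx\le C\int_\Omega(1-\rho)^{\alpha+1}\,dx\qquad\text{for all }t\in(0,T),$$ where $C$ depends only on $\alpha$. Furthermore, $$\sup_{0\le t\le T}\int_\Omega\Big(\frac1{1-\rho}\Big)^{-(\alpha+1)}dx\le C'\qquad\text{and}\qquad\int_0^T\!\!\int_\Omega\big|D(1-\rho)^{\frac{\alpha+1}2}\big|^2\,dx\,dt\le C',$$ where $C'$ depends only on $\alpha$, $T$ and an upper bound for $I(0)=\int_\Omega(1-\rho(x,0))^{\alpha+1}\,dx$. -/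

import Mathlib

open MeasureTheory Set Topology
open scoped Gradient Laplacian

/-- `ℝⁿ` with its Euclidean structure. -/
abbrev Space (n : ℕ) : Type := EuclideanSpace ℝ (Fin n)

/-- The divergence `∑ i, ∂F_i/∂x_i` of a vector field on `ℝⁿ`. -/
noncomputable def divergence {n : ℕ} (F : Space n → Space n) (x : Space n) : ℝ :=
  ∑ i : Fin n, (fderiv ℝ F x (EuclideanSpace.single i (1 : ℝ))) i

/-- Near `x` the boundary of `Ω` is a `C¹` hypersurface through `x` with `Ω` on one side of it,
and `ν` is the outer unit normal to `Ω` at `x`: near `x`, `Ω` is the set `{g < 0}`, where `g` is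
`C¹`, `g x = 0`, and the nonzero vector `∇ g x` is a positive multiple of the unit vector `ν`. -/
def IsOuterUnitNormal {n : ℕ} (Ω : Set (Space n)) (x ν : Space n) : Prop :=
  ‖ν‖ = 1 ∧ ∃ g : Space n → ℝ, ∃ c : ℝ,
    ContDiffAt ℝ 1 g x ∧ g x = 0 ∧ 0 < c ∧ ∇ g x = c • ν ∧ ∀ᶠ y in 𝓝 x, (y ∈ Ω ↔ g y < 0)

/-- The function `f` has derivative `m` at the boundary point `x` in the direction of the outer
normal `ν`; only values of `f` on the inner side of the boundary are used. -/
def HasNormalDeriv {n : ℕ} (f : Space n → ℝ) (m : ℝ) (x ν : Space n) : Prop :=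
  HasDerivWithinAt (fun s : ℝ => f (x + s • ν)) m (Iic 0) 0

/-- `Ω` is a bounded open set whose boundary is `Γd ∪ Γn`, and whose boundary is `C¹` away from the
closed set `S`, which has vanishing `(n-1)`-dimensional Hausdorff measure. For `S = ∅`, `Ω` is a
bounded `C¹` open set; a nonempty `S` allows for corners and edges of the domain, and for isolated
singular points (in codimension at least two) of a solution. -/
structure IsDirichletNeumannDomain {n : ℕ} (Ω Γd Γn S : Set (Space n)) : Prop where
  isOpen : IsOpen Ω
  isBounded : Bornology.IsBounded Ω
  frontier_eq : frontier Ω = Γd ∪ Γn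
  isClosed_exc : IsClosed S
  exc_null : Measure.hausdorffMeasure ((n : ℝ) - 1) S = 0
  exists_normal : ∀ x ∈ frontier Ω \ S, ∃ ν : Space n, IsOuterUnitNormal Ω x ν

/-- `f` is of class `C²` in `(0,T) × (Ω \ S)`, and of class `C¹` in `(0,T) × (closure Ω \ S)`. -/
def IsSmoothUpToBoundary {n : ℕ} (Ω S : Set (Space n)) (T : ℝ) (f : ℝ → Space n → ℝ) : Prop :=
  ContDiffOn ℝ 2 (fun p : ℝ × Space n => f p.1 p.2) (Ioo 0 T ×ˢ (Ω \ S)) ∧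
  ContDiffOn ℝ 1 (fun p : ℝ × Space n => f p.1 p.2) (Ioo 0 T ×ˢ (closure Ω \ S))

/-- `(u, ρ)` is a smooth solution of the Hughes system with viscosity `ε`,
`ρ_t - div (ρ (1 - ρ)² Du) = ε Δρ`, `|Du|² = 1 / (1 - ρ)²`, in `Ω` on the time interval `[0,T]`,
with `ρ = u = 0` on `Γd` and `ρ_ν = u_ν = 0` on `Γn`. Smoothness, the equations and the Neumann
condition refer to points outside the exceptional set `S`. When `S = ∅`, the bound on the first
derivatives follows from smoothness of `u` and `ρ` on the compact set `[0,T] × closure Ω`. -/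
structure IsHughesSolution {n : ℕ} (ε : ℝ) (Ω Γd Γn S : Set (Space n)) (T : ℝ)
    (u ρ : ℝ → Space n → ℝ) : Prop where
  smooth_u : IsSmoothUpToBoundary Ω S T u
  smooth_ρ : IsSmoothUpToBoundary Ω S T ρ
  continuous_ρ : ContinuousOn (fun p : ℝ × Space n => ρ p.1 p.2) (Icc 0 T ×ˢ closure Ω)
  bounded_derivatives : ∃ K : ℝ, ∀ t ∈ Ioo 0 T, ∀ x ∈ Ω \ S,
    |deriv (fun s => ρ s x) t| ≤ K ∧ ‖∇ (ρ t) x‖ ≤ K ∧ ‖∇ (u t) x‖ ≤ K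
  fokker_planck : ∀ t ∈ Ioo 0 T, ∀ x ∈ Ω \ S,
    deriv (fun s => ρ s x) t
      - divergence (fun y => (ρ t y * (1 - ρ t y) ^ 2) • ∇ (u t) y) x = ε * Δ (ρ t) x
  eikonal : ∀ t ∈ Ioo 0 T, ∀ x ∈ Ω \ S,
    ρ t x ≠ 1 ∧ ‖∇ (u t) x‖ ^ 2 = 1 / (1 - ρ t x) ^ 2
  dirichlet : ∀ t ∈ Ioo 0 T, ∀ x ∈ Γd, ρ t x = 0 ∧ u t x = 0
  neumann : ∀ t ∈ Ioo 0 T, ∀ x ∈ Γn \ S, ∀ ν : Space n, IsOuterUnitNormal Ω x ν →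
    HasNormalDeriv (ρ t) 0 x ν ∧ HasNormalDeriv (u t) 0 x ν

/-- The congestion integral `∫_Ω (1 - ρ(x,t))^(α+1) dx`; this is the `p`-th power of the
`L^p`-norm of `1 / (1 - ρ)` for `p = -(α+1)`. -/
noncomputable def congestion {n : ℕ} (Ω : Set (Space n)) (ρ : ℝ → Space n → ℝ) (α t : ℝ) : ℝ :=
  ∫ x in Ω, (1 - ρ t x) ^ (α + 1)

/-! ### Pointwise divergence calculus and the divergence theorem for interior test functions. -/

section Divergence

variable {n : ℕ}

/-! Write the density equation as `ρ_t = div F`, with `F = Dρ + ρ(1-ρ)² Du` (`flux`), and test it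
with `G(ρ)`, where `G` is `C¹` on `(-∞, 1)` and `G(0) = 0`. No boundary term arises, since `G(ρ)`
vanishes on `Γd` and `F·ν` vanishes on `Γn`, so `∫ G(ρ) ρ_t = -∫ G'(ρ) Dρ·F`
(`IsHughesSolution.integral_mul_deriv_eq`). The eikonal equation gives `|Du| = 1/(1-ρ)`, hence
`-Dρ·F ≤ -|Dρ|² + |ρ|(1-ρ)|Dρ|` (`IsHughesSolution.neg_inner_flux_le`). Everything else is a choice
of `G`.

For the congestion integral, `G(s) = (1-s)^α - 1`; the constant is subtracted to make `G(0) = 0`.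
Young's inequality bounds the tested part by `α(α+1)/2` times the congestion integral, minus a
dissipation term proportional to `∫ |D(1-ρ)^((α+1)/2)|²`. The subtracted constant leaves `-(α+1) ∫
ρ_t`, which has a good sign because mass does not increase
(`IsHughesSolution.integral_deriv_nonpos`). Gronwall's inequality and integration in time give the
two final bounds.

Three facts prepare this. First, `ρ` stays uniformly below `1`: bounded `Du` and the eikonal
equation keep `|1-ρ|` away from zero, and continuity in time forbids crossing that gap
(`IsHughesSolution.exists_bounds`). Second, `ρ ≥ 0`, by Gronwall for the integral of the cubed
negative part. Third, mass is nonincreasing, by testing with `1 - exp(-kρ)` and letting `k → ∞`;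
this needs no sign of a normal derivative on `Γd`.

The remaining work is a divergence theorem for the field `G(ρ)F`, which is `C¹` only inside `Ω \ S`,
bounded with bounded divergence, and has normal component tending to zero at regular boundary points
(`IsTangentialField.integral_divergence_eq_zero`). Near such a point one cuts off in a layer of
thickness `ε`: the cutoff gradient is `O(1/ε)`, the layer has volume `O(ε)`, and the normal
component is `o(1)`. Near `S` one cuts off on balls with `∑ r^(n-1)` small: a gradient `O(1/r)` on a
volume `O(r^n)` costs `O(r^(n-1))`. -/

theorem divergence_smul {ψ : Space n → ℝ} {W : Space n → Space n} {x : Space n}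
    (hψ : DifferentiableAt ℝ ψ x) (hW : DifferentiableAt ℝ W x) :
    divergence (fun y => ψ y • W y) x = fderiv ℝ ψ x (W x) + ψ x * divergence W x := by
  unfold divergence
  rw [fderiv_fun_smul hψ hW]
  have h : fderiv ℝ ψ x (W x) =
      ∑ i, fderiv ℝ ψ x (EuclideanSpace.single i (1 : ℝ)) * W x i := by
    conv_lhs => rw [← (EuclideanSpace.basisFun (Fin n) ℝ).sum_repr (W x)]
    simp [map_sum, mul_comm]
  rw [h, Finset.mul_sum, ← Finset.sum_add_distrib]
  refine Finset.sum_congr rfl fun i _ => ?_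
  simp
  ring

theorem divergence_add {V W : Space n → Space n} {x : Space n}
    (hV : DifferentiableAt ℝ V x) (hW : DifferentiableAt ℝ W x) :
    divergence (fun y => V y + W y) x = divergence V x + divergence W x := by
  unfold divergence
  rw [fderiv_fun_add hV hW, ← Finset.sum_add_distrib]
  simp

/-- The Riesz isomorphism is linear, so it commutes with differentiation; the divergence of the
gradient is then the trace of the second derivative in the standard basis. -/
theorem divergence_gradient {f : Space n → ℝ} {x : Space n} (hf : ContDiffAt ℝ 2 f x) :
    divergence (∇ f) x = Δ f x := by
  rw [InnerProductSpace.laplacian_eq_iteratedFDeriv_orthonormalBasis f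
    (EuclideanSpace.basisFun (Fin n) ℝ)]
  unfold divergence
  refine Finset.sum_congr rfl fun i _ => ?_
  have hd : DifferentiableAt ℝ (fderiv ℝ f) x :=
    (hf.fderiv_right (m := 1) (by norm_num)).differentiableAt (by norm_num)
  have h1 : ∇ f = fun y => (InnerProductSpace.toDual ℝ (Space n)).symm (fderiv ℝ f y) := rfl
  have h2 : HasFDerivAt (∇ f) (((InnerProductSpace.toDual ℝ (Space n)).symm
      |>.toContinuousLinearEquiv.toContinuousLinearMap).comp (fderiv ℝ (fderiv ℝ f) x)) x := by
    rw [h1]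
    exact ((InnerProductSpace.toDual ℝ (Space n)).symm.toContinuousLinearEquiv
      |>.toContinuousLinearMap.hasFDerivAt).comp x hd.hasFDerivAt
  rw [h2.fderiv, iteratedFDeriv_two_apply]
  simp only [EuclideanSpace.basisFun_apply, Matrix.cons_val_zero, Matrix.cons_val_one]
  set L := fderiv ℝ (fderiv ℝ f) x (EuclideanSpace.single i 1)
  have h3 := InnerProductSpace.toDual_symm_apply (𝕜 := ℝ) (x := EuclideanSpace.single i (1 : ℝ))
    (y := L)
  rw [EuclideanSpace.inner_single_right] at h3
  simpa using h3

theorem continuousOn_divergence {U : Set (Space n)} (hU : IsOpen U) {W : Space n → Space n}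
    (hW : ContDiffOn ℝ 1 W U) : ContinuousOn (divergence W) U := by
  have h := hW.continuousOn_fderiv_of_isOpen hU le_rfl
  unfold divergence
  refine continuousOn_finsetSum _ fun i _ => ?_
  exact (EuclideanSpace.proj (𝕜 := ℝ) i).continuous.comp_continuousOn
    (h.clm_apply continuousOn_const)

/-- The divergence theorem for test functions supported where the field is regular. -/
theorem integral_divergence_of_tsupport_subset {U Ω : Set (Space n)} (hU : IsOpen U) (hUΩ : U ⊆ Ω)
    {W : Space n → Space n} (hW : ContDiffOn ℝ 1 W U) {ψ : Space n → ℝ} (hψ : ContDiff ℝ 1 ψ)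
    (hc : HasCompactSupport ψ) (hs : tsupport ψ ⊆ U) :
    ∫ x in Ω, (fderiv ℝ ψ x (W x) + ψ x * divergence W x) = 0 := by
  have hdiff : ∀ x ∈ tsupport ψ, DifferentiableAt ℝ W x := fun x hx =>
    (hW.differentiableOn one_ne_zero).differentiableAt (hU.mem_nhds (hs hx))
  have hzero : ∀ x ∉ tsupport ψ, ψ x = 0 ∧ fderiv ℝ ψ x = 0 := fun x hx =>
    ⟨image_eq_zero_of_notMem_tsupport hx,
      image_eq_zero_of_notMem_tsupport fun h => hx (tsupport_fderiv_subset ℝ h)⟩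
  have key : ∀ f : Space n → ℝ, ContinuousOn f U → (∀ x ∉ tsupport ψ, f x = 0) →
      Integrable f := fun f hf h0 => by
    rw [← integrableOn_iff_integrable_of_support_subset (s := tsupport ψ)
      (fun x hx => by by_contra h; exact hx (h0 x h))]
    exact (hf.mono hs).integrableOn_compact hc
  have cψ : ContinuousOn (fderiv ℝ ψ) U := (hψ.continuous_fderiv one_ne_zero).continuousOn
  have cW := hW.continuousOn_fderiv_of_isOpen hU le_rfl
  rw [setIntegral_eq_integral_of_forall_compl_eq_zero]
  swap
  · intro x hx
    obtain ⟨h1, h2⟩ := hzero x fun h => hx (hUΩ (hs h))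
    simp [h1, h2]
  have hcomp : ∀ i, ∀ x ∈ tsupport ψ, HasFDerivAt (fun y => W y i)
      ((EuclideanSpace.proj (𝕜 := ℝ) i).comp (fderiv ℝ W x)) x := fun i x hx =>
    (EuclideanSpace.proj (𝕜 := ℝ) i).hasFDerivAt.comp x (hdiff x hx).hasFDerivAt
  -- `W` is regular only on `U`, so the coordinate expansion is checked on the support of `ψ`; off
  -- it both sides vanish.
  have e : (fun x => fderiv ℝ ψ x (W x) + ψ x * divergence W x) = fun x => ∑ i,
      (fderiv ℝ ψ x (EuclideanSpace.single i (1 : ℝ)) * W x i +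
        ψ x * fderiv ℝ (fun y => W y i) x (EuclideanSpace.single i (1 : ℝ))) := by
    funext x
    by_cases hx : x ∈ tsupport ψ
    · have h : fderiv ℝ ψ x (W x) =
          ∑ i, fderiv ℝ ψ x (EuclideanSpace.single i (1 : ℝ)) * W x i := by
        conv_lhs => rw [← (EuclideanSpace.basisFun (Fin n) ℝ).sum_repr (W x)]
        simp [map_sum, mul_comm]
      rw [h, divergence, Finset.mul_sum, ← Finset.sum_add_distrib]
      refine Finset.sum_congr rfl fun i _ => ?_
      rw [(hcomp i x hx).fderiv]
      simp
    · obtain ⟨h1, h2⟩ := hzero x hx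
      simp [h1, h2]
  have i1 : ∀ i, Integrable
      (fun x => fderiv ℝ ψ x (EuclideanSpace.single i (1 : ℝ)) * W x i) := fun i => by
    refine key _ ((cψ.clm_apply continuousOn_const).mul
      ((EuclideanSpace.proj (𝕜 := ℝ) i).continuous.comp_continuousOn hW.continuousOn)) ?_
    intro x hx
    simp [(hzero x hx).2]
  have i2 : ∀ i, Integrable (fun x => ψ x * fderiv ℝ (fun y => W y i) x
      (EuclideanSpace.single i (1 : ℝ))) := fun i => by
    have : (fun x => ψ x * fderiv ℝ (fun y => W y i) x (EuclideanSpace.single i (1 : ℝ))) =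
        fun x => ψ x * (fderiv ℝ W x (EuclideanSpace.single i (1 : ℝ))) i := by
      funext x
      by_cases hx : x ∈ tsupport ψ
      · rw [(hcomp i x hx).fderiv]; simp
      · simp [(hzero x hx).1]
    rw [this]
    refine key _ (hψ.continuous.continuousOn.mul
      ((EuclideanSpace.proj (𝕜 := ℝ) i).continuous.comp_continuousOn
        (cW.clm_apply continuousOn_const))) ?_
    intro x hx
    simp [(hzero x hx).1]
  rw [e, integral_finsetSum _ fun i _ => (i1 i).fun_add (i2 i)]
  refine Finset.sum_eq_zero fun i _ => ?_
  rw [integral_add (i1 i) (i2 i), integral_mul_fderiv_eq_neg_fderiv_mul_of_integrable (i1 i) (i2 i)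
    (key _ (hψ.continuous.continuousOn.mul
      ((EuclideanSpace.proj (𝕜 := ℝ) i).continuous.comp_continuousOn hW.continuousOn))
      fun x hx => by simp [(hzero x hx).1])
    (fun x _ => hψ.differentiable one_ne_zero x)
    (fun x hx => (hcomp i x hx).differentiableAt)]
  simp

end Divergence

/-! ### Cutoff profile and volume of boundary layers. -/

section Boundary

variable {n : ℕ}

theorem exists_bound_deriv_smoothTransition :
    ∃ C : ℝ, 0 ≤ C ∧ (∀ s, |deriv Real.smoothTransition s| ≤ C) ∧
      ∀ s ∉ Icc (0 : ℝ) 1, deriv Real.smoothTransition s = 0 := by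
  have h0 : ∀ s ∉ Icc (0 : ℝ) 1, deriv Real.smoothTransition s = 0 := by
    intro s hs
    rw [mem_Icc, not_and_or, not_le, not_le] at hs
    rcases hs with hs | hs
    · have : Real.smoothTransition =ᶠ[𝓝 s] fun _ => 0 := by
        filter_upwards [Iio_mem_nhds hs] with r hr
        exact Real.smoothTransition.zero_of_nonpos (le_of_lt hr)
      rw [this.deriv_eq]; simp
    · have : Real.smoothTransition =ᶠ[𝓝 s] fun _ => 1 := by
        filter_upwards [Ioi_mem_nhds hs] with r hr
        exact Real.smoothTransition.one_of_one_le (le_of_lt hr)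
      rw [this.deriv_eq]; simp
  have hc : Continuous (deriv Real.smoothTransition) :=
    (Real.smoothTransition.contDiff (n := 1)).continuous_deriv le_rfl
  obtain ⟨C, hC⟩ := isCompact_Icc.exists_bound_of_continuousOn (s := Icc (0 : ℝ) 1)
    hc.continuousOn
  refine ⟨max C 0, le_max_right _ _, fun s => ?_, h0⟩
  by_cases hs : s ∈ Icc (0 : ℝ) 1
  · exact (hC s hs).trans (le_max_left _ _)
  · rw [h0 s hs, abs_zero]; exact le_max_right _ _

/-- A layer of thickness `ε` along a level set of a function that is strictly increasing in a
direction has volume `O(ε)`, since it has `≈ 1/ε` disjoint translates. -/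
theorem exists_measureReal_strip_le {g : Space n → ℝ} {x ν : Space n} {R c : ℝ} (hR : 0 < R)
    (hc : 0 < c) (hν : ‖ν‖ ≤ 1) (hg : ∀ y ∈ Metric.ball x R, DifferentiableAt ℝ g y)
    (hd : ∀ y ∈ Metric.ball x R, c ≤ fderiv ℝ g y ν) :
    ∃ C : ℝ, 0 ≤ C ∧ ∀ ε, 0 < ε →
      volume.real (Metric.ball x R ∩ g ⁻¹' Ioo (-ε) 0) ≤ C * ε := by
  have hmono : ∀ a ∈ Metric.ball x R, ∀ s : ℝ, 0 ≤ s → a + s • ν ∈ Metric.ball x R →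
      c * s ≤ g (a + s • ν) - g a := by
    intro a ha s hs has
    have hin : ∀ σ ∈ Icc 0 s, a + σ • ν ∈ Metric.ball x R := by
      intro σ hσ
      rcases hs.eq_or_lt with rfl | hs'
      · obtain rfl : σ = 0 := le_antisymm hσ.2 hσ.1
        simpa using ha
      · have := (convex_ball x R).add_smul_sub_mem ha has (t := σ / s)
          ⟨div_nonneg hσ.1 hs, (div_le_one hs').2 hσ.2⟩
        rw [add_sub_cancel_left, smul_smul, div_mul_cancel₀ _ hs'.ne'] at this
        exact this
    have hder : ∀ σ ∈ Icc 0 s, HasDerivAt (fun σ : ℝ => g (a + σ • ν))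
        (fderiv ℝ g (a + σ • ν) ν) σ := by
      intro σ hσ
      have h1 : HasDerivAt (fun σ : ℝ => a + σ • ν) ν σ := by
        simpa using ((hasDerivAt_id σ).smul_const ν).const_add a
      exact (hg _ (hin σ hσ)).hasFDerivAt.comp_hasDerivAt σ h1
    have := (convex_Icc 0 s).mul_sub_le_image_sub_of_le_deriv (f := fun σ : ℝ => g (a + σ • ν))
      (C := c) (fun σ hσ => (hder σ hσ).continuousAt.continuousWithinAt)
      (fun σ hσ => (hder σ (interior_subset hσ)).differentiableAt.differentiableWithinAt)
      (fun σ hσ => by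
        rw [(hder σ (interior_subset hσ)).deriv]
        exact hd _ (hin σ (interior_subset hσ)))
      0 (left_mem_Icc.2 hs) s (right_mem_Icc.2 hs) hs
    simpa using this
  set V := volume.real (Metric.ball x (2 * R))
  refine ⟨V / (c * R), by positivity, fun ε hε => ?_⟩
  set A := Metric.ball x R ∩ g ⁻¹' Ioo (-ε) 0 with hA
  have hAo : IsOpen A := ContinuousOn.isOpen_inter_preimage
    (fun y hy => (hg y hy).continuousAt.continuousWithinAt) Metric.isOpen_ball isOpen_Ioo
  -- Moving by `τ` along `ν` raises `g` by at least `c * τ = ε`, so it carries the layer off itself.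
  set τ := ε / c with hτ
  have hτ0 : 0 < τ := by positivity
  -- At least `R / τ` translates, all with shift `k * τ ≤ R` since `k ≤ ⌊R / τ⌋`; hence they stay in
  -- the ball of radius `2 * R`.
  set N := ⌊R / τ⌋₊ + 1 with hN
  let B : ℕ → Set (Space n) := fun k => (fun y => y + (-(k * τ)) • ν) ⁻¹' A
  have hBv : ∀ k, volume.real (B k) = volume.real A := fun k => by
    simp only [B, measureReal_def, measure_preimage_add_right]
  have hBm : ∀ k, MeasurableSet (B k) := fun k =>
    (hAo.preimage (by fun_prop)).measurableSet
  have hdisj : ∀ k l : ℕ, k < l → Disjoint (B k) (B l) := by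
    intro k l hkl
    rw [Set.disjoint_left]
    intro y hk hl
    set s : ℝ := (l - k : ℝ) * τ with hs
    have hlk : (1 : ℝ) ≤ l - k := by
      have : (k : ℝ) + 1 ≤ l := by exact_mod_cast hkl
      linarith
    have e : y + (-(k * τ)) • ν = (y + (-(l * τ)) • ν) + s • ν := by
      rw [hs, add_assoc, ← add_smul]; congr 2; ring
    have h1 := hmono (y + (-(l * τ)) • ν) hl.1 s (by positivity) (by rw [← e]; exact hk.1)
    rw [← e] at h1
    have h2 : ε ≤ c * s := by
      have : c * τ = ε := by rw [hτ]; field_simp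
      calc ε = c * (1 * τ) := by rw [one_mul, this]
        _ ≤ c * s := by rw [hs]; gcongr
    have h3 : g (y + (-(k * τ)) • ν) < 0 := hk.2.2
    have h4 : -ε < g (y + (-(l * τ)) • ν) := hl.2.1
    linarith
  have hsub : (⋃ k ∈ Finset.range N, B k) ⊆ Metric.ball x (2 * R) := by
    intro y hy
    simp only [mem_iUnion, Finset.mem_range] at hy
    obtain ⟨k, hk, hy⟩ := hy
    have hkR : k * τ ≤ R := by
      have : (k : ℝ) ≤ R / τ :=
        (Nat.cast_le.2 (Nat.lt_succ_iff.1 hk)).trans (Nat.floor_le (by positivity))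
      calc k * τ ≤ R / τ * τ := by gcongr
        _ = R := by field_simp
    have h1 : dist (y + (-(k * τ)) • ν) x < R := hy.1
    have h2 : dist y (y + (-(k * τ)) • ν) ≤ R := by
      rw [dist_eq_norm, sub_add_cancel_left, norm_neg, norm_smul, norm_neg, Real.norm_eq_abs,
        abs_of_nonneg (by positivity)]
      calc k * τ * ‖ν‖ ≤ k * τ * 1 := by gcongr
        _ ≤ R := by simpa using hkR
    rw [Metric.mem_ball]
    linarith [dist_triangle y (y + (-(k * τ)) • ν) x]
  have hfin : volume (Metric.ball x (2 * R)) ≠ ⊤ := measure_ball_lt_top.ne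
  have hsum : volume.real (⋃ k ∈ Finset.range N, B k) = ∑ k ∈ Finset.range N, volume.real (B k) :=
    measureReal_biUnion_finset₀ (fun k _ l _ hkl => by
      rcases lt_or_gt_of_ne hkl with h | h
      · exact (hdisj k l h).aedisjoint
      · exact (hdisj l k h).symm.aedisjoint)
      (fun k _ => (hBm k).nullMeasurableSet)
      (fun k hk => ne_top_of_le_ne_top hfin (measure_mono fun y hy =>
        hsub (mem_biUnion (by exact hk) hy)))
  have hle : N * volume.real A ≤ V := by
    have := measureReal_mono hsub hfin
    rw [hsum] at this
    simpa [hBv] using this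
  have hNR : R / τ ≤ N := by
    rw [hN]; push_cast; exact (Nat.lt_floor_add_one _).le
  have h5 : R / τ * volume.real A ≤ V :=
    (mul_le_mul_of_nonneg_right hNR measureReal_nonneg).trans hle
  have h6 : volume.real A ≤ V * τ / R := by
    rw [le_div_iff₀ hR]
    calc volume.real A * R = (R / τ * volume.real A) * τ := by field_simp
      _ ≤ V * τ := by gcongr
  calc volume.real A ≤ V * τ / R := h6
    _ = V / (c * R) * ε := by rw [hτ]; field_simp

end Boundary

/-! ### Vanishing boundary flux near a regular boundary point. -/

section TangentialField

variable {n : ℕ}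

/-- A `C¹` vector field on `Ω \ S`, bounded together with its divergence, whose normal component
tends to zero at the regular boundary points. -/
structure IsTangentialField (Ω S : Set (Space n)) (W : Space n → Space n) (K : ℝ) : Prop where
  contDiffOn : ContDiffOn ℝ 1 W (Ω \ S)
  norm_le : ∀ x ∈ Ω \ S, ‖W x‖ ≤ K
  abs_divergence_le : ∀ x ∈ Ω \ S, |divergence W x| ≤ K
  tendsto_inner : ∀ x ∈ frontier Ω \ S, ∀ ν, IsOuterUnitNormal Ω x ν →
    Filter.Tendsto (fun y => inner ℝ (W y) ν) (𝓝[Ω \ S] x) (𝓝 0)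

/-- The integral of `div (ψ W)` over `Ω`. -/
noncomputable def greenIntegral (Ω : Set (Space n)) (W : Space n → Space n) (ψ : Space n → ℝ) : ℝ :=
  ∫ x in Ω, (fderiv ℝ ψ x (W x) + ψ x * divergence W x)

/-- Lets one defining function serve all boundary points near a given one. At such a point `g ≥ 0`
because the point is outside the open set `Ω`, and `g > 0` would keep a whole neighbourhood out of
`Ω`. -/
theorem IsOuterUnitNormal.of_eventually {Ω : Set (Space n)} {g : Space n → ℝ} {z : Space n}
    (hΩ : IsOpen Ω) (hz : z ∈ frontier Ω) (hg : ContDiffAt ℝ 1 g z) (hgrad : ∇ g z ≠ 0)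
    (hloc : ∀ᶠ y in 𝓝 z, (y ∈ Ω ↔ g y < 0)) :
    IsOuterUnitNormal Ω z (‖∇ g z‖⁻¹ • ∇ g z) := by
  have hn : 0 < ‖∇ g z‖ := norm_pos_iff.2 hgrad
  refine ⟨by rw [norm_smul, norm_inv, norm_norm, inv_mul_cancel₀ hn.ne'], g, ‖∇ g z‖, hg, ?_, hn,
    by rw [smul_smul, mul_inv_cancel₀ hn.ne', one_smul], hloc⟩
  rw [hΩ.frontier_eq] at hz
  have h1 : 0 ≤ g z := by
    have := hloc.self_of_nhds
    by_contra h
    exact hz.2 (this.2 (not_le.1 h))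
  refine le_antisymm (not_lt.1 fun h => ?_) h1
  have h2 : ∀ᶠ y in 𝓝 z, 0 < g y := hg.continuousAt.eventually_const_lt h
  obtain ⟨y, hy, hyΩ⟩ := (mem_closure_iff_frequently.1 hz.1).and_eventually (h2.and hloc) |>.exists
  exact absurd (hyΩ.2.1 hy) (not_lt.2 hyΩ.1.le)

/-- At `z` the gradient of `g` is a multiple of the normal, and replacing `Dg(z)` by `Dg(y)` costs
`|Dg(y) - Dg(z)| K`, which tends to zero. -/
theorem IsTangentialField.tendsto_fderiv {Ω S : Set (Space n)} {W : Space n → Space n} {K : ℝ}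
    (hW : IsTangentialField Ω S W K) (hΩ : IsOpen Ω) {g : Space n → ℝ} {z : Space n}
    (hz : z ∈ frontier Ω \ S) (hg : ContDiffAt ℝ 1 g z) (hgrad : ∇ g z ≠ 0)
    (hloc : ∀ᶠ y in 𝓝 z, (y ∈ Ω ↔ g y < 0)) :
    Filter.Tendsto (fun y => fderiv ℝ g y (W y)) (𝓝[Ω \ S] z) (𝓝 0) := by
  have h1 := (hW.tendsto_inner z hz _ (.of_eventually hΩ hz.1 hg hgrad hloc)).const_mul ‖∇ g z‖
  have h2 : Filter.Tendsto (fun y => (fderiv ℝ g y - fderiv ℝ g z) (W y)) (𝓝[Ω \ S] z) (𝓝 0) := by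
    have hc : Filter.Tendsto (fun y => ‖fderiv ℝ g y - fderiv ℝ g z‖ * K) (𝓝[Ω \ S] z) (𝓝 0) := by
      have := ((hg.fderiv_right (m := 0) (by norm_num)).continuousAt.tendsto.mono_left
        (nhdsWithin_le_nhds (s := Ω \ S))).sub_const (fderiv ℝ g z)
      rw [sub_self] at this
      simpa using this.norm.mul_const K
    refine squeeze_zero_norm' ?_ hc
    filter_upwards [self_mem_nhdsWithin] with y hy
    exact (ContinuousLinearMap.le_opNorm _ _).trans
      (mul_le_mul_of_nonneg_left (hW.norm_le y hy) (norm_nonneg _))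
  have h3 := h1.add h2
  rw [mul_zero, add_zero] at h3
  refine h3.congr fun y => ?_
  rw [inner_smul_right, ← mul_assoc, mul_inv_cancel₀ (norm_ne_zero_iff.2 hgrad), one_mul,
    real_inner_comm, inner_gradient_left]
  simp

/-- Multiplying `ψ` by a cutoff that depends on `g / ε` gives an interior test function, for which
the integral is zero. The error is an average of `Dg·W` over a layer of thickness comparable to `ε`,
and `Dg·W` tends to zero at the boundary uniformly on the support of `ψ`. -/
theorem IsTangentialField.exists_ball_of_mem_frontier {Ω S : Set (Space n)}
    {W : Space n → Space n} {K : ℝ} (hW : IsTangentialField Ω S W K) (hΩ : IsOpen Ω)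
    (hS : IsClosed S) {x ν : Space n} (hx : x ∈ frontier Ω \ S) (hν : IsOuterUnitNormal Ω x ν) :
    ∃ R > 0, ∀ ψ : Space n → ℝ, ContDiff ℝ 1 ψ → tsupport ψ ⊆ Metric.ball x R →
      greenIntegral Ω W ψ = 0 := by
  obtain ⟨hν1, g, c, hg, hgx, hc, hgrad, hloc⟩ := hν
  have e1 : ∀ᶠ y in 𝓝 x, c / 2 ≤ fderiv ℝ g y ν := by
    have h1 : ContinuousAt (fun y => fderiv ℝ g y ν) x :=
      (hg.fderiv_right (m := 0) (by norm_num)).continuousAt.clm_apply continuousAt_const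
    have h2 : fderiv ℝ g x ν = c := by
      rw [← inner_gradient_left, hgrad, real_inner_smul_left, real_inner_self_eq_norm_sq, hν1]
      simp
    exact (h1.eventually_const_lt (u := c / 2) (by simp only [h2]; linarith)).mono fun y hy => hy.le
  obtain ⟨R, hR, hball⟩ := Metric.eventually_nhds_iff_ball.1
    (((hg.eventually (by simp)).and hloc).and (e1.and (hS.isOpen_compl.mem_nhds hx.2)))
  refine ⟨R, hR, fun ψ hψ hsupp => ?_⟩
  have hgc : ∀ y ∈ Metric.ball x R, ContDiffAt ℝ 1 g y := fun y hy => (hball y hy).1.1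
  have hgΩ : ∀ y ∈ Metric.ball x R, (y ∈ Ω ↔ g y < 0) := fun y hy => (hball y hy).1.2
  have hgν : ∀ y ∈ Metric.ball x R, c / 2 ≤ fderiv ℝ g y ν := fun y hy => (hball y hy).2.1
  have hSb : ∀ y ∈ Metric.ball x R, y ∉ S := fun y hy => (hball y hy).2.2
  have hgd : ∀ y ∈ Metric.ball x R, DifferentiableAt ℝ g y := fun y hy =>
    (hgc y hy).differentiableAt one_ne_zero
  have hgcont : ContinuousOn g (Metric.ball x R) := fun y hy =>
    (hgd y hy).continuousAt.continuousWithinAt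
  have hlocz : ∀ z ∈ Metric.ball x R, ∀ᶠ y in 𝓝 z, (y ∈ Ω ↔ g y < 0) := fun z hz => by
    filter_upwards [Metric.isOpen_ball.mem_nhds hz] with y hy using hgΩ y hy
  have hcomp : IsCompact (tsupport ψ) := Metric.isCompact_of_isClosed_isBounded
    (isClosed_tsupport ψ) (Metric.isBounded_ball.subset hsupp)
  have hzero : ∀ y ∉ tsupport ψ, ψ y = 0 ∧ fderiv ℝ ψ y = 0 := fun y hy =>
    ⟨image_eq_zero_of_notMem_tsupport hy,
      image_eq_zero_of_notMem_tsupport fun h => hy (tsupport_fderiv_subset ℝ h)⟩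
  set Ω' := Metric.ball x R ∩ Ω with hΩ'
  have hΩ'o : IsOpen Ω' := Metric.isOpen_ball.inter hΩ
  have hΩ'S : Ω' ⊆ Ω \ S := fun y hy => ⟨hy.2, hSb y hy.1⟩
  have hΩ'fin : volume Ω' < ⊤ := (measure_mono inter_subset_left).trans_lt measure_ball_lt_top
  have : IsFiniteMeasure (volume.restrict Ω') := isFiniteMeasure_restrict.2 hΩ'fin.ne
  have hW' : ContDiffOn ℝ 1 W Ω' := hW.contDiffOn.mono hΩ'S
  set f : Space n → ℝ := fun y => fderiv ℝ ψ y (W y) + ψ y * divergence W y with hf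
  have hres : greenIntegral Ω W ψ = ∫ y in Ω', f y := by
    refine setIntegral_eq_of_subset_of_forall_sdiff_eq_zero hΩ.measurableSet inter_subset_right
      fun y hy => ?_
    obtain ⟨h1, h2⟩ := hzero y fun h => hy.2 ⟨hsupp h, hy.1⟩
    simp [h1, h2]
  have hfc : ContinuousOn f Ω' :=
    ((hψ.continuous_fderiv one_ne_zero).continuousOn.clm_apply hW'.continuousOn).add
      (hψ.continuous.continuousOn.mul (continuousOn_divergence hΩ'o hW'))
  have hsψ : HasCompactSupport ψ := hcomp
  obtain ⟨Mψ, hMψ⟩ := hψ.continuous.bounded_above_of_compact_support hsψ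
  obtain ⟨Md, hMd⟩ := (hψ.continuous_fderiv one_ne_zero).bounded_above_of_compact_support
    (hsψ.fderiv ℝ)
  have hMψ0 : 0 ≤ Mψ := (norm_nonneg _).trans (hMψ x)
  have hMd0 : 0 ≤ Md := (norm_nonneg _).trans (hMd x)
  have hfb : ∀ y ∈ Ω', ‖f y‖ ≤ Md * K + Mψ * K := by
    intro y hy
    refine (norm_add_le _ _).trans (add_le_add ?_ ?_)
    · exact (ContinuousLinearMap.le_opNorm _ _).trans
        (mul_le_mul (hMd y) (hW.norm_le y (hΩ'S hy)) (norm_nonneg _) hMd0)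
    · rw [norm_mul]
      exact mul_le_mul (hMψ y) (hW.abs_divergence_le y (hΩ'S hy)) (norm_nonneg _) hMψ0
  -- the normal component, extended by zero, is continuous
  set q : Space n → ℝ := Ω.indicator fun y => fderiv ℝ g y (W y) with hq
  have hqc : ContinuousOn q (Metric.ball x R) := by
    intro z hz
    refine ContinuousAt.continuousWithinAt ?_
    by_cases hzΩ : z ∈ Ω
    · have h1 : ContinuousAt (fun y => fderiv ℝ g y (W y)) z :=
        ((hgc z hz).fderiv_right (m := 0) (by norm_num)).continuousAt.clm_apply
          (hW'.continuousOn.continuousAt (hΩ'o.mem_nhds ⟨hz, hzΩ⟩))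
      refine h1.congr ?_
      filter_upwards [hΩ.mem_nhds hzΩ] with y hy
      rw [hq, indicator_of_mem hy]
    · have hqz : q z = 0 := indicator_of_notMem hzΩ _
      rw [ContinuousAt, hqz]
      by_cases hzc : z ∈ closure Ω
      · have hzf : z ∈ frontier Ω \ S := ⟨by rw [hΩ.frontier_eq]; exact ⟨hzc, hzΩ⟩, hSb z hz⟩
        have hgr : ∇ g z ≠ 0 := fun h => by
          have := hgν z hz
          rw [← inner_gradient_left, h, inner_zero_left] at this
          linarith
        have h1 := hW.tendsto_fderiv hΩ hzf (hgc z hz) hgr (hlocz z hz)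
        have h2 : 𝓝[Ω \ S] z = 𝓝[Ω] z :=
          nhdsWithin_inter_of_mem' (mem_nhdsWithin_of_mem_nhds
            (hS.isOpen_compl.mem_nhds (hSb z hz)))
        rw [h2] at h1
        rw [← nhdsWithin_univ z, ← union_compl_self Ω, nhdsWithin_union]
        refine Filter.Tendsto.sup (h1.congr' ?_) (tendsto_const_nhds.congr' ?_)
        · filter_upwards [self_mem_nhdsWithin] with y hy
          rw [hq, indicator_of_mem hy]
        · filter_upwards [self_mem_nhdsWithin] with y hy
          rw [hq, indicator_of_notMem hy]
      · refine tendsto_const_nhds.congr' ?_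
        filter_upwards [isClosed_closure.isOpen_compl.mem_nhds hzc] with y hy
        rw [hq, indicator_of_notMem fun h => hy (subset_closure h)]
  have hunif : ∀ δ > 0, ∃ ε₀ > 0, ∀ y ∈ tsupport ψ, y ∈ Ω → -ε₀ < g y →
      |fderiv ℝ g y (W y)| < δ := by
    intro δ hδ
    -- The part of the support where the normal component is not small is compact and lies in `Ω`,
    -- so `g` has a negative maximum on it.
    set B := tsupport ψ ∩ (fun y => |q y|) ⁻¹' Ici δ with hB
    have hBc : IsCompact B := hcomp.of_isClosed_subset
      (((hqc.mono hsupp).abs).preimage_isClosed_of_isClosed (isClosed_tsupport ψ) isClosed_Ici)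
      inter_subset_left
    have hBΩ : ∀ y ∈ B, y ∈ Ω := fun y hy => by
      by_contra h
      have h2 : δ ≤ |q y| := hy.2
      rw [hq, indicator_of_notMem h, abs_zero] at h2
      exact absurd h2 (not_le.2 hδ)
    have main : ∃ ε₀ > 0, ∀ y ∈ B, g y ≤ -ε₀ := by
      rcases B.eq_empty_or_nonempty with he | hne
      · exact ⟨1, one_pos, by simp [he]⟩
      · obtain ⟨y₀, hy₀, hmax⟩ := hBc.exists_isMaxOn hne
          (hgcont.mono fun y hy => hsupp hy.1)
        refine ⟨-g y₀, neg_pos.2 ((hgΩ y₀ (hsupp hy₀.1)).1 (hBΩ y₀ hy₀)), fun y hy => ?_⟩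
        rw [neg_neg]
        exact hmax hy
    obtain ⟨ε₀, hε₀, h⟩ := main
    refine ⟨ε₀, hε₀, fun y hy hyΩ hgy => ?_⟩
    by_contra hcon
    have : y ∈ B := ⟨hy, by
      rw [mem_preimage, hq, indicator_of_mem hyΩ]
      exact not_lt.1 hcon⟩
    linarith [h y this]
  obtain ⟨Cv, hCv0, hCv⟩ := exists_measureReal_strip_le hR (half_pos hc) hν1.le hgd hgν
  obtain ⟨Cσ, hCσ0, hCσ, hσ0⟩ := exists_bound_deriv_smoothTransition
  set σ := Real.smoothTransition
  -- Equal to `0` where `g ≥ -ε / 2` and to `1` where `g ≤ -ε`, so the product with `ψ` has support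
  -- inside `Ω`.
  let θ : ℝ → Space n → ℝ := fun ε y => σ (-2 / ε * g y - 1)
  have hθd : ∀ ε, ∀ y ∈ Metric.ball x R, HasFDerivAt (θ ε)
      ((deriv σ (-2 / ε * g y - 1) * (-2 / ε)) • fderiv ℝ g y) y := by
    intro ε y hy
    have h1 : HasFDerivAt (fun y => -2 / ε * g y - 1) ((-2 / ε) • fderiv ℝ g y) y :=
      ((hgd y hy).hasFDerivAt.const_mul _).sub_const 1
    have h2 : HasDerivAt σ (deriv σ (-2 / ε * g y - 1)) (-2 / ε * g y - 1) :=
      ((Real.smoothTransition.contDiff (n := 1)).differentiable one_ne_zero _).hasDerivAt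
    rw [mul_smul]
    exact h2.comp_hasFDerivAt y h1
  have hθc : ∀ ε, ContinuousOn (θ ε) (Metric.ball x R) := fun ε y hy =>
    (hθd ε y hy).continuousAt.continuousWithinAt
  have hθ1 : ∀ ε y, ‖θ ε y‖ ≤ 1 := fun ε y => by
    rw [Real.norm_of_nonneg (Real.smoothTransition.nonneg _)]
    exact Real.smoothTransition.le_one _
  have hident : ∀ ε > 0, ∫ y in Ω', θ ε y * f y =
      -∫ y in Ω', ψ y * (deriv σ (-2 / ε * g y - 1) * (-2 / ε) * fderiv ℝ g y (W y)) := by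
    intro ε hε
    have hprod : ContDiff ℝ 1 fun y => ψ y * θ ε y := by
      rw [contDiff_iff_contDiffAt]
      intro y
      by_cases hy : y ∈ tsupport ψ
      · exact hψ.contDiffAt.mul ((Real.smoothTransition.contDiffAt (n := 1)).comp y
          ((contDiffAt_const.mul (hgc y (hsupp hy))).sub contDiffAt_const))
      · refine (contDiffAt_const (c := (0 : ℝ))).congr_of_eventuallyEq ?_
        filter_upwards [(isClosed_tsupport ψ).isOpen_compl.mem_nhds hy] with z hz
        rw [(hzero z hz).1, zero_mul]
    have hts : tsupport (fun y => ψ y * θ ε y) ⊆ tsupport ψ ∩ g ⁻¹' Iic (-ε / 2) := by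
      refine closure_minimal ?_
        ((hgcont.mono hsupp).preimage_isClosed_of_isClosed (isClosed_tsupport ψ) isClosed_Iic)
      intro y hy
      refine ⟨subset_tsupport _ (left_ne_zero_of_mul hy), ?_⟩
      by_contra hcon
      have hcon' : -ε / 2 < g y := not_le.1 hcon
      refine right_ne_zero_of_mul hy (Real.smoothTransition.zero_of_nonpos ?_)
      have : -2 / ε * g y ≤ -2 / ε * (-ε / 2) :=
        mul_le_mul_of_nonpos_left hcon'.le (div_nonpos_of_nonpos_of_nonneg (by norm_num) hε.le)
      have h2 : -2 / ε * (-ε / 2) = 1 := by field_simp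
      linarith
    have hts' : tsupport (fun y => ψ y * θ ε y) ⊆ Ω' := fun y hy => by
      have h := hts hy
      refine ⟨hsupp h.1, (hgΩ y (hsupp h.1)).2 ?_⟩
      have : g y ≤ -ε / 2 := h.2
      linarith
    have h0 := integral_divergence_of_tsupport_subset hΩ'o Subset.rfl hW' hprod
      (hcomp.of_isClosed_subset (isClosed_tsupport _) fun y hy => (hts hy).1) hts'
    have hpt : ∀ y ∈ Ω', fderiv ℝ (fun y => ψ y * θ ε y) y (W y) +
        ψ y * θ ε y * divergence W y = θ ε y * f y +
        ψ y * (deriv σ (-2 / ε * g y - 1) * (-2 / ε) * fderiv ℝ g y (W y)) := by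
      intro y hy
      have h1 := ((hψ.differentiable one_ne_zero y).hasFDerivAt.fun_mul (hθd ε y hy.1)).fderiv
      rw [h1, hf]
      simp
      ring
    have hθf : IntegrableOn (fun y => θ ε y * f y) Ω' := by
      refine Integrable.of_bound (C := Md * K + Mψ * K)
        (((hθc ε).mono inter_subset_left).mul hfc |>.aestronglyMeasurable hΩ'o.measurableSet) ?_
      refine (ae_restrict_iff' hΩ'o.measurableSet).2 (.of_forall fun y hy => ?_)
      rw [norm_mul]
      exact (mul_le_of_le_one_left (norm_nonneg _) (hθ1 ε y)).trans (hfb y hy)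
    have hei : IntegrableOn
        (fun y => ψ y * (deriv σ (-2 / ε * g y - 1) * (-2 / ε) * fderiv ℝ g y (W y))) Ω' := by
      obtain ⟨Mq, hMq⟩ := hcomp.exists_bound_of_continuousOn (hqc.mono hsupp)
      refine Integrable.of_bound (C := Mψ * (Cσ * (2 / ε) * |Mq|)) ?_ ?_
      · refine ContinuousOn.aestronglyMeasurable ?_ hΩ'o.measurableSet
        refine hψ.continuous.continuousOn.mul (ContinuousOn.mul (ContinuousOn.mul ?_
          continuousOn_const) ?_)
        · exact ((Real.smoothTransition.contDiff (n := 1)).continuous_deriv le_rfl).comp_continuousOn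
            ((continuousOn_const.mul (hgcont.mono inter_subset_left)).sub continuousOn_const)
        · refine (hqc.mono inter_subset_left).congr fun y hy => ?_
          rw [hq, indicator_of_mem hy.2]
      · refine (ae_restrict_iff' hΩ'o.measurableSet).2 (.of_forall fun y hy => ?_)
        by_cases hyt : y ∈ tsupport ψ
        · have h2 := (hMq y hyt).trans (le_abs_self Mq)
          rw [hq, indicator_of_mem hy.2] at h2
          rw [norm_mul, norm_mul, norm_mul]
          have h3 : ‖-2 / ε‖ = 2 / ε := by
            rw [neg_div, norm_neg, Real.norm_of_nonneg (by positivity)]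
          rw [h3]
          have h4 := hCσ (-2 / ε * g y - 1)
          rw [← Real.norm_eq_abs] at h4
          gcongr
          exact hMψ y
        · rw [(hzero y hyt).1, zero_mul, norm_zero]
          positivity
    rw [setIntegral_congr_fun hΩ'o.measurableSet hpt, integral_add hθf hei] at h0
    linarith
  have hsmall : ∀ δ > 0, |∫ y in Ω', f y| ≤ Mψ * (Cσ * 2 * δ) * (Cv * 2) := by
    intro δ hδ
    obtain ⟨ε₀, hε₀, hε₀q⟩ := hunif δ hδ
    have hest : ∀ ε > 0, 2 * ε < ε₀ →
        |∫ y in Ω', θ ε y * f y| ≤ Mψ * (Cσ * 2 * δ) * (Cv * 2) := by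
      intro ε hε hεε₀
      rw [hident ε hε, abs_neg]
      -- The derivative of the cutoff lives on `-ε ≤ g ≤ -ε / 2`; the factor `2` places this closed
      -- range inside an open layer.
      set T := Metric.ball x R ∩ g ⁻¹' Ioo (-(2 * ε)) 0 with hT
      have hTΩ : T ⊆ Ω' := fun y hy => ⟨hy.1, (hgΩ y hy.1).2 hy.2.2⟩
      rw [setIntegral_eq_of_subset_of_forall_sdiff_eq_zero hΩ'o.measurableSet hTΩ]
      · have hTfin : volume T < ⊤ := (measure_mono hTΩ).trans_lt hΩ'fin
        have h1 : ∀ y ∈ T, ‖ψ y * (deriv σ (-2 / ε * g y - 1) * (-2 / ε) * fderiv ℝ g y (W y))‖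
            ≤ Mψ * (Cσ * (2 / ε) * δ) := by
          intro y hy
          by_cases hyt : y ∈ tsupport ψ
          · have h2 : ‖fderiv ℝ g y (W y)‖ ≤ δ :=
              (hε₀q y hyt (hTΩ hy).2 (by linarith [hy.2.1])).le
            have h3 : ‖-2 / ε‖ = 2 / ε := by
              rw [neg_div, norm_neg, Real.norm_of_nonneg (by positivity)]
            have h4 : ‖deriv σ (-2 / ε * g y - 1)‖ ≤ Cσ := hCσ _
            rw [norm_mul, norm_mul, norm_mul, h3]
            gcongr
            exact hMψ y
          · rw [(hzero y hyt).1, zero_mul, norm_zero]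
            positivity
        refine (norm_setIntegral_le_of_norm_le_const hTfin h1).trans ?_
        calc Mψ * (Cσ * (2 / ε) * δ) * volume.real T
            ≤ Mψ * (Cσ * (2 / ε) * δ) * (Cv * (2 * ε)) := by
              gcongr
              exact hCv _ (by positivity)
          _ = Mψ * (Cσ * 2 * δ) * (Cv * 2) := by field_simp
      · intro y hy
        rw [hσ0, zero_mul, zero_mul, mul_zero]
        intro hcon
        refine hy.2 ⟨hy.1.1, ?_, (hgΩ y hy.1.1).1 hy.1.2⟩
        have h1 : -2 / ε * g y ≤ 2 := by linarith [hcon.2]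
        have h2 : g y < 0 := (hgΩ y hy.1.1).1 hy.1.2
        have h3 : -2 / ε * g y = 2 * (-g y) / ε := by ring
        rw [h3, div_le_iff₀ hε] at h1
        linarith
    have hlim : Filter.Tendsto (fun k : ℕ => ∫ y in Ω', θ (1 / ((k : ℝ) + 1)) y * f y) Filter.atTop
        (𝓝 (∫ y in Ω', f y)) := by
      refine tendsto_integral_of_dominated_convergence (fun _ => Md * K + Mψ * K) (fun k =>
        ((hθc _).mono inter_subset_left).mul hfc |>.aestronglyMeasurable hΩ'o.measurableSet)
        (integrable_const _) (fun k => ?_) ?_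
      · refine (ae_restrict_iff' hΩ'o.measurableSet).2 (.of_forall fun y hy => ?_)
        rw [norm_mul]
        exact (mul_le_of_le_one_left (norm_nonneg _) (hθ1 _ y)).trans (hfb y hy)
      · refine (ae_restrict_iff' hΩ'o.measurableSet).2 (.of_forall fun y hy => ?_)
        refine tendsto_const_nhds.congr' ?_
        have hgy : 0 < -g y := neg_pos.2 ((hgΩ y hy.1).1 hy.2)
        filter_upwards [tendsto_one_div_add_atTop_nhds_zero_nat.eventually_lt_const hgy] with k hk
        have hk0 : (0 : ℝ) < 1 / ((k : ℝ) + 1) := by positivity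
        have : θ (1 / ((k : ℝ) + 1)) y = 1 := by
          refine Real.smoothTransition.one_of_one_le ?_
          have h3 : -2 / (1 / ((k : ℝ) + 1)) * g y = 2 * (-g y) / (1 / ((k : ℝ) + 1)) := by ring
          have h4 : 2 ≤ 2 * (-g y) / (1 / ((k : ℝ) + 1)) := by
            rw [le_div_iff₀ hk0]; linarith
          linarith
        rw [this, one_mul]
    refine le_of_tendsto hlim.abs ?_
    filter_upwards [tendsto_one_div_add_atTop_nhds_zero_nat.eventually_lt_const (half_pos hε₀)]
      with k hk
    exact hest _ (by positivity) (by linarith)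
  rw [hres, ← abs_nonpos_iff]
  refine le_of_forall_pos_le_add fun η hη => ?_
  have hA : 0 ≤ Mψ * (Cσ * 2) * (Cv * 2) := by positivity
  refine (hsmall (η / (Mψ * (Cσ * 2) * (Cv * 2) + 1)) (by positivity)).trans ?_
  rw [zero_add]
  calc Mψ * (Cσ * 2 * (η / (Mψ * (Cσ * 2) * (Cv * 2) + 1))) * (Cv * 2)
      = η * ((Mψ * (Cσ * 2) * (Cv * 2)) / (Mψ * (Cσ * 2) * (Cv * 2) + 1)) := by ring
    _ ≤ η * 1 := by
      gcongr
      exact div_le_one_of_le₀ (by linarith) (by linarith)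
    _ = η := mul_one η

end TangentialField

/-! ### Coverings of the exceptional set and the associated cutoffs. -/

section Covering

/-- Hausdorff measure decreases in the dimension, and in dimension `n` it is proportional to
Lebesgue measure because both are translation invariant. -/
theorem volume_eq_zero_of_hausdorffMeasure_eq_zero {n : ℕ} {S : Set (Space n)}
    (h : Measure.hausdorffMeasure ((n : ℝ) - 1) S = 0) : volume S = 0 := by
  have h1 : Measure.hausdorffMeasure (Module.finrank ℝ (Space n)) S = 0 := by
    refine le_antisymm ?_ zero_le
    rw [← h, finrank_euclideanSpace_fin]
    exact Measure.hausdorffMeasure_mono (by linarith) S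
  rw [Measure.isAddLeftInvariant_eq_smul (volume : Measure (Space n))
    (Measure.hausdorffMeasure (Module.finrank ℝ (Space n))), Measure.smul_apply, h1, smul_zero]

/-- A compact set of vanishing `d`-dimensional Hausdorff measure is covered by finitely many balls
of radius at most `1` with arbitrarily small sum of `d`-th powers of the radii. -/
theorem IsCompact.exists_finset_ball_cover {X : Type*} [MetricSpace X] [Nonempty X] [MeasurableSpace X]
    [BorelSpace X] {s : Set X} (hs : IsCompact s) {d : ℝ}
    (h : Measure.hausdorffMeasure d s = 0) {ε : ℝ} (hε : 0 < ε) :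
    ∃ (F : Finset ℕ) (x : ℕ → X) (r : ℕ → ℝ), (∀ k ∈ F, 0 < r k ∧ r k ≤ 1) ∧
      s ⊆ ⋃ k ∈ F, Metric.ball (x k) (r k) ∧ ∑ k ∈ F, r k ^ d < ε := by
  classical
  have hε2 : (0 : ENNReal) < ENNReal.ofReal (ε / 2) := ENNReal.ofReal_pos.2 (half_pos hε)
  rw [Measure.hausdorffMeasure_apply] at h
  -- Diameters at most `1 / 2` leave room for radii that exceed the diameters strictly and are still
  -- at most `1`.
  have h1 := (le_iSup₂ (f := fun (r : ENNReal) (_ : 0 < r) =>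
        ⨅ (t : ℕ → Set X) (_ : s ⊆ ⋃ n, t n) (_ : ∀ n, Metric.ediam (t n) ≤ r),
          ∑' n, ⨆ _ : (t n).Nonempty, Metric.ediam (t n) ^ d) (ENNReal.ofReal (1 / 2))
          (ENNReal.ofReal_pos.2 (by norm_num))).trans h.le
  obtain ⟨t, ht⟩ := iInf_lt_iff.1 (h1.trans_lt hε2)
  obtain ⟨hst, ht⟩ := iInf_lt_iff.1 ht
  obtain ⟨htd, ht⟩ := iInf_lt_iff.1 ht
  -- A summable slack pays for enlarging each diameter, possibly zero, to a positive radius.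
  obtain ⟨δ, hδ0, hδ⟩ := ENNReal.exists_pos_sum_of_countable hε2.ne' ℕ
  have hr : ∀ k, ∃ r : ℝ, 0 < r ∧ r ≤ 1 ∧ Metric.ediam (t k) < ENNReal.ofReal r ∧
      ENNReal.ofReal r ^ d < Metric.ediam (t k) ^ d + δ k ∨ ¬ (t k).Nonempty ∨
      Metric.ediam (t k) ^ d = ⊤ := by
    intro k
    by_cases htop : Metric.ediam (t k) ^ d = ⊤
    · exact ⟨1, .inr (.inr htop)⟩
    have hfin : Metric.ediam (t k) ≠ ⊤ := ne_top_of_le_ne_top ENNReal.ofReal_ne_top (htd k)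
    set D := (Metric.ediam (t k)).toReal with hD
    have hDe : Metric.ediam (t k) = ENNReal.ofReal D := (ENNReal.ofReal_toReal hfin).symm
    have hD0 : 0 ≤ D := ENNReal.toReal_nonneg
    have hD1 : D < 1 := by
      have := htd k
      rw [hDe, ENNReal.ofReal_le_ofReal_iff (by norm_num)] at this
      linarith
    have hc : ContinuousAt (fun r : ℝ => ENNReal.ofReal r ^ d) D :=
      (ENNReal.continuous_rpow_const.comp ENNReal.continuous_ofReal).continuousAt
    have hlt : (fun r : ℝ => ENNReal.ofReal r ^ d) D < Metric.ediam (t k) ^ d + δ k := by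
      simp only [← hDe]
      exact ENNReal.lt_add_right htop (by exact_mod_cast (hδ0 k).ne')
    have hev := (hc.eventually_lt_const hlt).filter_mono (nhdsWithin_le_nhds (s := Ioi D))
    obtain ⟨r, hr1, hr2⟩ := (hev.and (Ioo_mem_nhdsGT hD1)).exists
    refine ⟨r, .inl ⟨hD0.trans_lt hr2.1, hr2.2.le, ?_, hr1⟩⟩
    rw [hDe]
    exact (ENNReal.ofReal_lt_ofReal_iff (hD0.trans_lt hr2.1)).2 hr2.1
  choose r hr using hr
  have hr' : ∀ k, (t k).Nonempty → 0 < r k ∧ r k ≤ 1 ∧ Metric.ediam (t k) < ENNReal.ofReal (r k) ∧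
      ENNReal.ofReal (r k) ^ d < Metric.ediam (t k) ^ d + δ k := by
    intro k hk
    rcases hr k with h | h | h
    · exact h
    · exact absurd hk h
    -- An infinite power occurs only for zero diameter and `d < 0`; the finite sum excludes it.
    · have h2 := ENNReal.le_tsum (f := fun n => ⨆ _ : (t n).Nonempty, Metric.ediam (t n) ^ d) k
      simp only [hk, iSup_pos, h] at h2
      exact absurd (h2.trans_lt ht) (by simp)
  let x : ℕ → X := fun k => if h : (t k).Nonempty then h.some else Classical.arbitrary X
  have hx : ∀ k, (t k).Nonempty → t k ⊆ Metric.ball (x k) (r k) := by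
    intro k hk y hy
    have hxk : x k ∈ t k := by
      simp only [x, hk, dif_pos]
      exact hk.some_mem
    have h2 := (Metric.edist_le_ediam_of_mem hy hxk).trans_lt (hr' k hk).2.2.1
    rw [edist_dist, ENNReal.ofReal_lt_ofReal_iff (hr' k hk).1] at h2
    exact h2
  obtain ⟨F, hF⟩ := hs.elim_finite_subcover
    (fun k => if (t k).Nonempty then Metric.ball (x k) (r k) else ∅)
    (fun k => by
      by_cases hk : (t k).Nonempty
      · simp only [hk, if_true]; exact Metric.isOpen_ball
      · simp only [hk, if_false]; exact isOpen_empty)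
    (fun y hy => by
      obtain ⟨k, hk⟩ := mem_iUnion.1 (hst hy)
      have hk' : (t k).Nonempty := ⟨y, hk⟩
      refine mem_iUnion.2 ⟨k, ?_⟩
      simp only [hk', if_true]
      exact hx k hk' hk)
  refine ⟨F.filter fun k => (t k).Nonempty, x, r, fun k hk => ?_, fun y hy => ?_, ?_⟩
  · have h2 := hr' k (Finset.mem_filter.1 hk).2
    exact ⟨h2.1, h2.2.1⟩
  · obtain ⟨k, hkF, hk⟩ := mem_iUnion₂.1 (hF hy)
    by_cases hk' : (t k).Nonempty
    · simp only [hk', if_true] at hk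
      exact mem_iUnion₂.2 ⟨k, Finset.mem_filter.2 ⟨hkF, hk'⟩, hk⟩
    · simp [hk'] at hk
  · set G := F.filter fun k => (t k).Nonempty
    have hG : ∀ k ∈ G, (t k).Nonempty := fun k hk => (Finset.mem_filter.1 hk).2
    rw [← ENNReal.ofReal_lt_ofReal_iff hε, ENNReal.ofReal_sum_of_nonneg
      fun k hk => Real.rpow_nonneg (hr' k (hG k hk)).1.le _]
    calc ∑ k ∈ G, ENNReal.ofReal (r k ^ d)
        ≤ ∑ k ∈ G, ((⨆ _ : (t k).Nonempty, Metric.ediam (t k) ^ d) + δ k) := by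
          refine Finset.sum_le_sum fun k hk => ?_
          have h2 := (hr' k (hG k hk)).2.2.2.le
          rw [ENNReal.ofReal_rpow_of_pos (hr' k (hG k hk)).1] at h2
          simpa only [hG k hk, iSup_pos] using h2
      _ = ∑ k ∈ G, (⨆ _ : (t k).Nonempty, Metric.ediam (t k) ^ d) + ∑ k ∈ G, (δ k : ENNReal) :=
          Finset.sum_add_distrib
      _ ≤ ∑' k, (⨆ _ : (t k).Nonempty, Metric.ediam (t k) ^ d) + ∑' k, (δ k : ENNReal) :=
          add_le_add (ENNReal.sum_le_tsum _) (ENNReal.sum_le_tsum _)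
      _ < ENNReal.ofReal (ε / 2) + ENNReal.ofReal (ε / 2) := ENNReal.add_lt_add ht hδ
      _ = ENNReal.ofReal ε := by
          rw [← ENNReal.ofReal_add (half_pos hε).le (half_pos hε).le, add_halves]

/-- Cutoff functions with the natural bound on the gradient. -/
theorem exists_bump_fderiv_le (n : ℕ) : ∃ C : ℝ, 0 ≤ C ∧ ∀ (x : Space n) (r : ℝ), 0 < r →
    ∃ η : Space n → ℝ, ContDiff ℝ 1 η ∧ (∀ y, 0 ≤ η y ∧ η y ≤ 1) ∧
      (∀ y ∈ Metric.ball x r, η y = 1) ∧ (∀ y ∉ Metric.ball x (2 * r), η y = 0) ∧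
      (∀ y, ‖fderiv ℝ η y‖ ≤ C / r) ∧ ∀ y ∉ Metric.ball x (2 * r), fderiv ℝ η y = 0 := by
  let b : ContDiffBump (0 : Space n) := ⟨1, 2, by norm_num, by norm_num⟩
  have hb : ContDiff ℝ 1 b := b.contDiff
  obtain ⟨C, hC⟩ := (hb.continuous_fderiv one_ne_zero).bounded_above_of_compact_support
    (b.hasCompactSupport.fderiv ℝ)
  refine ⟨C, (norm_nonneg _).trans (hC 0), fun x r hr => ?_⟩
  have h0 : ∀ y ∉ Metric.ball x (2 * r), b (r⁻¹ • (y - x)) = 0 := fun y hy => by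
    refine b.zero_of_le_dist ?_
    rw [dist_zero_right, norm_smul, norm_inv, Real.norm_of_nonneg hr.le, ← dist_eq_norm,
      inv_mul_eq_div, le_div_iff₀ hr]
    simpa using hy
  refine ⟨fun y => b (r⁻¹ • (y - x)), hb.comp (by fun_prop), fun y => ⟨b.nonneg, b.le_one⟩,
    fun y hy => ?_, h0, fun y => ?_, fun y hy => ?_⟩
  · refine b.one_of_mem_closedBall ?_
    rw [mem_closedBall_zero_iff, norm_smul, norm_inv, Real.norm_of_nonneg hr.le, ← dist_eq_norm,
      inv_mul_eq_div, div_le_iff₀ hr, one_mul]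
    exact (Metric.mem_ball.1 hy).le
  · have h1 : HasFDerivAt (fun y : Space n => r⁻¹ • (y - x))
        (r⁻¹ • ContinuousLinearMap.id ℝ (Space n)) y :=
      ((hasFDerivAt_id y).sub_const x).const_smul r⁻¹
    have h2 := ((hb.differentiable one_ne_zero (r⁻¹ • (y - x))).hasFDerivAt.comp y h1).fderiv
    have h3 : fderiv ℝ (fun y => b (r⁻¹ • (y - x))) y = r⁻¹ • fderiv ℝ b (r⁻¹ • (y - x)) := by
      refine h2.trans ?_
      ext v
      simp
    rw [h3, norm_smul, norm_inv, Real.norm_of_nonneg hr.le, inv_mul_eq_div]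
    gcongr
    exact hC _
  -- A zero of a nonnegative function is a minimum; this covers the bounding sphere as well as the
  -- exterior.
  · refine IsLocalMin.fderiv_eq_zero (Filter.Eventually.of_forall fun z => ?_)
    simp only [h0 y hy]
    exact b.nonneg

/-- A cutoff function vanishing on finitely many balls. -/
theorem exists_cutoff_fderiv_le (n : ℕ) : ∃ C : ℝ, 0 ≤ C ∧
    ∀ (F : Finset ℕ) (x : ℕ → Space n) (r : ℕ → ℝ), (∀ k ∈ F, 0 < r k) →
    ∃ χ : Space n → ℝ, ContDiff ℝ 1 χ ∧ (∀ y, 0 ≤ χ y ∧ χ y ≤ 1) ∧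
      (∀ k ∈ F, ∀ y ∈ Metric.ball (x k) (r k), χ y = 0) ∧
      (∀ y, 1 - χ y ≤ ∑ k ∈ F, (Metric.ball (x k) (2 * r k)).indicator 1 y) ∧
      ∀ y, ‖fderiv ℝ χ y‖ ≤
        ∑ k ∈ F, (Metric.ball (x k) (2 * r k)).indicator (fun _ => C / r k) y := by
  classical
  obtain ⟨C, hC0, hC⟩ := exists_bump_fderiv_le n
  refine ⟨C, hC0, fun F x r hr => ?_⟩
  induction F using Finset.induction_on with
  | empty => exact ⟨fun _ => 1, contDiff_const, by simp, by simp, by simp, by simp⟩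
  | insert k F hk ih =>
    obtain ⟨χ, h1, h2, h3, h4, h5⟩ := ih fun j hj => hr j (Finset.mem_insert_of_mem hj)
    obtain ⟨η, g1, g2, g3, g4, g5, g6⟩ := hC (x k) (r k) (hr k (Finset.mem_insert_self _ _))
    -- In the product `∏ (1 - η_k)` every factor is between `0` and `1`, so the gradients simply add
    -- up.
    refine ⟨fun y => (1 - η y) * χ y, (contDiff_const.sub g1).mul h1, fun y => ?_,
      fun j hj y hy => ?_, fun y => ?_, fun y => ?_⟩
    · have := g2 y
      have := h2 y
      constructor
      · exact mul_nonneg (by linarith) (by linarith)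
      · exact mul_le_one₀ (by linarith) (by linarith) (by linarith)
    · rcases Finset.mem_insert.1 hj with rfl | hj
      · simp [g3 y hy]
      · simp [h3 j hj y hy]
    · rw [Finset.sum_insert hk]
      have e1 : η y ≤ (Metric.ball (x k) (2 * r k)).indicator 1 y := by
        by_cases hy : y ∈ Metric.ball (x k) (2 * r k)
        · rw [indicator_of_mem hy]; exact (g2 y).2
        · rw [indicator_of_notMem hy, g4 y hy]
      have e2 := h4 y
      have e3 : η y * χ y ≤ η y := mul_le_of_le_one_right (g2 y).1 (h2 y).2
      nlinarith
    · rw [Finset.sum_insert hk]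
      have hd : fderiv ℝ (fun y => (1 - η y) * χ y) y =
          (1 - η y) • fderiv ℝ χ y + χ y • (-fderiv ℝ η y) := by
        have := ((g1.differentiable one_ne_zero y).hasFDerivAt.const_sub 1).fun_mul
          (h1.differentiable one_ne_zero y).hasFDerivAt
        exact this.fderiv
      have e1 : ‖fderiv ℝ η y‖ ≤
          (Metric.ball (x k) (2 * r k)).indicator (fun _ => C / r k) y := by
        by_cases hy : y ∈ Metric.ball (x k) (2 * r k)
        · rw [indicator_of_mem hy]; exact g5 y
        · rw [indicator_of_notMem hy, g6 y hy, norm_zero]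
      rw [hd, add_comm]
      refine (norm_add_le _ _).trans (add_le_add ?_ ?_)
      · rw [norm_smul, norm_neg, Real.norm_of_nonneg (h2 y).1]
        exact (mul_le_of_le_one_left (norm_nonneg _) (h2 y).2).trans e1
      · rw [norm_smul, Real.norm_of_nonneg (by linarith [(g2 y).2])]
        exact (mul_le_of_le_one_left (norm_nonneg _) (by linarith [(g2 y).1])).trans (h5 y)

end Covering

/-! ### The divergence theorem for tangential fields. -/

section DivergenceTheorem

variable {n : ℕ}

theorem IsTangentialField.integrableOn {Ω S : Set (Space n)} {W : Space n → Space n} {K : ℝ}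
    (hW : IsTangentialField Ω S W K) (hΩ : IsOpen Ω) (hb : Bornology.IsBounded Ω) (hS : IsClosed S)
    (hS0 : volume S = 0) {ψ : Space n → ℝ} (hψ : ContDiff ℝ 1 ψ) :
    IntegrableOn (fun x => fderiv ℝ ψ x (W x) + ψ x * divergence W x) Ω := by
  have hcl : IsCompact (closure Ω) := hb.isCompact_closure
  obtain ⟨M₁, hM₁⟩ := hcl.exists_bound_of_continuousOn hψ.continuous.continuousOn
  obtain ⟨M₂, hM₂⟩ := hcl.exists_bound_of_continuousOn
    (hψ.continuous_fderiv one_ne_zero).continuousOn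
  have hU : IsOpen (Ω \ S) := hΩ.sdiff hS
  have hfin : volume (Ω \ S) < ⊤ := (hb.subset sdiff_subset).measure_lt_top
  have hae : (Ω \ S : Set (Space n)) =ᵐ[volume] Ω := sdiff_null_ae_eq_self hS0
  refine IntegrableOn.congr_set_ae ?_ hae.symm
  have : IsFiniteMeasure (volume.restrict (Ω \ S)) := isFiniteMeasure_restrict.2 hfin.ne
  refine Integrable.of_bound (C := M₂ * K + M₁ * K)
    (ContinuousOn.aestronglyMeasurable ?_ hU.measurableSet) ?_
  · exact ((hψ.continuous_fderiv one_ne_zero).continuousOn.clm_apply hW.contDiffOn.continuousOn).add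
      (hψ.continuous.continuousOn.mul (continuousOn_divergence hU hW.contDiffOn))
  · refine (ae_restrict_iff' hU.measurableSet).2 (.of_forall fun y hy => ?_)
    have hyc := subset_closure hy.1
    refine (norm_add_le _ _).trans (add_le_add ?_ ?_)
    · exact (ContinuousLinearMap.le_opNorm _ _).trans
        (mul_le_mul (hM₂ y hyc) (hW.norm_le y hy) (norm_nonneg _)
          ((norm_nonneg _).trans (hM₂ y hyc)))
    · rw [norm_mul]
      exact mul_le_mul (hM₁ y hyc) (hW.abs_divergence_le y hy) (norm_nonneg _)
        ((norm_nonneg _).trans (hM₁ y hyc))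

theorem IsTangentialField.greenIntegral_add {Ω S : Set (Space n)} {W : Space n → Space n} {K : ℝ}
    (hW : IsTangentialField Ω S W K) (hΩ : IsOpen Ω) (hb : Bornology.IsBounded Ω) (hS : IsClosed S)
    (hS0 : volume S = 0) {φ ψ : Space n → ℝ} (hφ : ContDiff ℝ 1 φ) (hψ : ContDiff ℝ 1 ψ) :
    greenIntegral Ω W (fun x => φ x + ψ x) = greenIntegral Ω W φ + greenIntegral Ω W ψ := by
  unfold greenIntegral
  rw [← integral_add (hW.integrableOn hΩ hb hS hS0 hφ) (hW.integrableOn hΩ hb hS hS0 hψ)]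
  congr 1
  funext x
  rw [fderiv_fun_add (hφ.differentiable one_ne_zero x) (hψ.differentiable one_ne_zero x)]
  simp
  ring

theorem greenIntegral_eq_zero_of_forall {Ω : Set (Space n)} (hΩ : IsOpen Ω)
    {W : Space n → Space n} {ψ : Space n → ℝ} (h : ∀ x ∈ Ω, ψ x = 0) :
    greenIntegral Ω W ψ = 0 := by
  refine setIntegral_eq_zero_of_forall_eq_zero fun x hx => ?_
  have : ψ =ᶠ[𝓝 x] fun _ => 0 := by
    filter_upwards [hΩ.mem_nhds hx] with y hy using h y hy
  rw [this.fderiv_eq, h x hx]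
  simp

theorem IsTangentialField.exists_ball {Ω S : Set (Space n)} {W : Space n → Space n} {K : ℝ}
    (hW : IsTangentialField Ω S W K) (hΩ : IsOpen Ω) (hS : IsClosed S)
    (hν : ∀ x ∈ frontier Ω \ S, ∃ ν : Space n, IsOuterUnitNormal Ω x ν) {x : Space n}
    (hx : x ∈ closure Ω \ S) :
    ∃ R > 0, ∀ ψ : Space n → ℝ, ContDiff ℝ 1 ψ → tsupport ψ ⊆ Metric.ball x R →
      greenIntegral Ω W ψ = 0 := by
  by_cases hxΩ : x ∈ Ω
  · obtain ⟨R, hR, hball⟩ := Metric.isOpen_iff.1 (hΩ.sdiff hS) x ⟨hxΩ, hx.2⟩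
    refine ⟨R, hR, fun ψ hψ hs => ?_⟩
    exact integral_divergence_of_tsupport_subset (hΩ.sdiff hS) sdiff_subset hW.contDiffOn hψ
      (Metric.isCompact_of_isClosed_isBounded (isClosed_tsupport ψ)
        (Metric.isBounded_ball.subset hs)) (hs.trans hball)
  · have hxf : x ∈ frontier Ω \ S := ⟨by rw [hΩ.frontier_eq]; exact ⟨hx.1, hxΩ⟩, hx.2⟩
    obtain ⟨ν, h⟩ := hν x hxf
    exact hW.exists_ball_of_mem_frontier hΩ hS hxf h

/-- Localization by compactness. Multiplying by one more factor `1 - η_x` does not change the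
integral, since the piece removed is supported in a good ball; once the balls cover the support,
nothing is left in `Ω`. -/
theorem IsTangentialField.greenIntegral_eq_zero_of_disjoint {Ω S : Set (Space n)}
    {W : Space n → Space n} {K : ℝ}
    (hW : IsTangentialField Ω S W K) (hΩ : IsOpen Ω) (hb : Bornology.IsBounded Ω) (hS : IsClosed S)
    (hS0 : volume S = 0) (hν : ∀ x ∈ frontier Ω \ S, ∃ ν : Space n, IsOuterUnitNormal Ω x ν)
    {ψ : Space n → ℝ} (hψ : ContDiff ℝ 1 ψ) (hd : Disjoint (tsupport ψ ∩ closure Ω) S) :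
    greenIntegral Ω W ψ = 0 := by
  classical
  have hK : IsCompact (tsupport ψ ∩ closure Ω) :=
    hb.isCompact_closure.inter_left (isClosed_tsupport ψ)
  have hloc : ∀ x, ∃ R > 0, x ∈ tsupport ψ ∩ closure Ω → ∀ ψ : Space n → ℝ, ContDiff ℝ 1 ψ →
      tsupport ψ ⊆ Metric.ball x R → greenIntegral Ω W ψ = 0 := by
    intro x
    by_cases hx : x ∈ tsupport ψ ∩ closure Ω
    · obtain ⟨R, hR, h⟩ := hW.exists_ball hΩ hS hν ⟨hx.2, disjoint_left.1 hd hx⟩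
      exact ⟨R, hR, fun _ => h⟩
    · exact ⟨1, one_pos, fun h => absurd h hx⟩
  choose R hR hloc using hloc
  let η : ∀ x : Space n, ContDiffBump x := fun x =>
    ⟨R x / 3, R x / 2, by linarith [hR x], by linarith [hR x]⟩
  have hηc : ∀ x, ContDiff ℝ 1 (η x) := fun x => (η x).contDiff
  obtain ⟨t, htK, ht⟩ := hK.elim_nhds_subcover (fun x => Metric.ball x (R x / 3))
    (fun x _ => Metric.ball_mem_nhds x (by linarith [hR x]))
  have hind : ∀ t : Finset (Space n), (∀ x ∈ t, x ∈ tsupport ψ ∩ closure Ω) →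
      greenIntegral Ω W ψ = greenIntegral Ω W (fun y => (∏ x ∈ t, (1 - η x y)) * ψ y) := by
    intro t
    induction t using Finset.induction_on with
    | empty => simp
    | insert x t hx ih =>
      intro h
      rw [ih fun y hy => h y (Finset.mem_insert_of_mem hy)]
      have hφ : ContDiff ℝ 1 fun y => (∏ x ∈ t, (1 - η x y)) * ψ y :=
        (contDiff_prod fun x _ => contDiff_const.sub (hηc x)).mul hψ
      set φ : Space n → ℝ := fun y => (∏ x ∈ t, (1 - η x y)) * ψ y with hφdef
      have e1 : φ = fun y => η x y * φ y + (∏ z ∈ insert x t, (1 - η z y)) * ψ y := by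
        funext y
        rw [Finset.prod_insert hx, hφdef]
        ring
      conv_lhs => rw [e1]
      rw [hW.greenIntegral_add hΩ hb hS hS0 ((hηc x).mul hφ)
        ((contDiff_prod fun x _ => contDiff_const.sub (hηc x)).mul hψ),
        hloc x (h x (Finset.mem_insert_self _ _)) _ ((hηc x).mul hφ), zero_add]
      refine tsupport_mul_subset_left.trans ?_
      rw [(η x).tsupport_eq]
      exact Metric.closedBall_subset_ball (by simp only [η]; linarith [hR x])
  rw [hind t htK]
  refine greenIntegral_eq_zero_of_forall hΩ fun y hy => ?_
  by_cases hyt : y ∈ tsupport ψ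
  · obtain ⟨x, hxt, hxy⟩ := mem_iUnion₂.1 (ht ⟨hyt, subset_closure hy⟩)
    have : η x y = 1 := (η x).one_of_mem_closedBall (Metric.ball_subset_closedBall hxy)
    rw [Finset.prod_eq_zero hxt (by rw [this, sub_self]), zero_mul]
  · rw [image_eq_zero_of_notMem_tsupport hyt, mul_zero]

/-- **Divergence theorem** for bounded fields that are tangential to the boundary, on domains that
are `C¹` up to a closed set of vanishing `(n-1)`-dimensional Hausdorff measure. -/
theorem IsTangentialField.integral_divergence_eq_zero {Ω S : Set (Space n)}
    {W : Space n → Space n} {K : ℝ}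
    (hW : IsTangentialField Ω S W K) (hΩ : IsOpen Ω) (hb : Bornology.IsBounded Ω) (hS : IsClosed S)
    (hSH : Measure.hausdorffMeasure ((n : ℝ) - 1) S = 0)
    (hν : ∀ x ∈ frontier Ω \ S, ∃ ν : Space n, IsOuterUnitNormal Ω x ν) :
    ∫ x in Ω, divergence W x = 0 := by
  have hS0 := volume_eq_zero_of_hausdorffMeasure_eq_zero hSH
  have hone : greenIntegral Ω W (fun _ => 1) = ∫ x in Ω, divergence W x := by
    simp [greenIntegral]
  obtain ⟨C, hC0, hC⟩ := exists_cutoff_fderiv_le n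
  set V := volume.real (Metric.ball (0 : Space n) 1)
  have hae : (Ω \ S : Set (Space n)) =ᵐ[volume] Ω := sdiff_null_ae_eq_self hS0
  have hU : IsOpen (Ω \ S) := hΩ.sdiff hS
  have key : ∀ ε > 0, |∫ x in Ω, divergence W x| ≤ |K| * (C + 1) * (2 ^ n * V) * ε := by
    intro ε hε
    have hSc : IsCompact (S ∩ closure Ω) := hb.isCompact_closure.inter_left hS
    obtain ⟨F, x, r, hr, hcov, hsum⟩ := hSc.exists_finset_ball_cover
      (measure_mono_null inter_subset_left hSH) hε
    obtain ⟨χ, h1, h2, h3, h4, h5⟩ := hC F x r fun k hk => (hr k hk).1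
    have hχ0 : greenIntegral Ω W χ = 0 := by
      refine hW.greenIntegral_eq_zero_of_disjoint hΩ hb hS hS0 hν h1 ?_
      rw [disjoint_left]
      rintro y ⟨hy, hyc⟩ hyS
      obtain ⟨k, hk, hyk⟩ := mem_iUnion₂.1 (hcov ⟨hyS, hyc⟩)
      refine (notMem_tsupport_iff_eventuallyEq.2 ?_) hy
      filter_upwards [Metric.isOpen_ball.mem_nhds hyk] with z hz using h3 k hk z hz
    let B : ℕ → Set (Space n) := fun k => Metric.ball (x k) (2 * r k)
    -- `C / r` comes from the gradient of the cutoff and the extra `1 / r` absorbs the term `(1 - χ)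
    -- div W`, since `r ≤ 1`.
    let G : Space n → ℝ := fun y => ∑ k ∈ F, (B k).indicator (fun _ => |K| * ((C + 1) / r k)) y
    have hBint : ∀ k, Integrable ((B k).indicator fun _ : Space n => |K| * ((C + 1) / r k)) :=
      fun k => (integrable_indicator_iff Metric.isOpen_ball.measurableSet).2
        (integrableOn_const measure_ball_lt_top.ne)
    have hGint : Integrable G := integrable_finsetSum _ fun k _ => hBint k
    have hG0 : ∀ y, 0 ≤ G y := fun y => Finset.sum_nonneg fun k hk =>
      indicator_nonneg (fun _ _ => by have := (hr k hk).1; positivity) y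
    have hpt : ∀ y ∈ Ω \ S, ‖(fderiv ℝ χ y (W y) + χ y * divergence W y) - divergence W y‖ ≤ G y := by
      intro y hy
      have e1 : ‖fderiv ℝ χ y (W y)‖ ≤ ‖fderiv ℝ χ y‖ * |K| :=
        (ContinuousLinearMap.le_opNorm _ _).trans
          (mul_le_mul_of_nonneg_left ((hW.norm_le y hy).trans (le_abs_self K)) (norm_nonneg _))
      have e2 : ‖(1 - χ y) * divergence W y‖ ≤ (1 - χ y) * |K| := by
        rw [norm_mul, Real.norm_of_nonneg (by linarith [(h2 y).2])]
        exact mul_le_mul_of_nonneg_left ((hW.abs_divergence_le y hy).trans (le_abs_self K))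
          (by linarith [(h2 y).2])
      have e3 : (fderiv ℝ χ y (W y) + χ y * divergence W y) - divergence W y =
          fderiv ℝ χ y (W y) - (1 - χ y) * divergence W y := by ring
      rw [e3]
      refine (norm_sub_le _ _).trans ((add_le_add e1 e2).trans ?_)
      rw [← add_mul]
      refine (mul_le_mul_of_nonneg_right (add_le_add (h5 y) (h4 y)) (abs_nonneg K)).trans ?_
      rw [← Finset.sum_add_distrib, Finset.sum_mul]
      refine Finset.sum_le_sum fun k hk => ?_
      by_cases hyk : y ∈ B k
      · have hrk := hr k hk
        simp only [B] at hyk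
        simp only [B, indicator_of_mem hyk, Pi.one_apply]
        rw [mul_comm, add_div]
        gcongr
        exact (one_le_div hrk.1).2 hrk.2
      · simp only [B] at hyk
        simp [B, indicator_of_notMem hyk]
    have hi1 := hW.integrableOn hΩ hb hS hS0 h1
    have hi2 : IntegrableOn (divergence W) Ω := by
      simpa using hW.integrableOn hΩ hb hS hS0 (contDiff_const (c := (1 : ℝ)))
    have hdiff : ∫ x in Ω, divergence W x =
        -∫ y in Ω \ S, ((fderiv ℝ χ y (W y) + χ y * divergence W y) - divergence W y) := by
      rw [setIntegral_congr_set hae, integral_sub hi1 hi2]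
      rw [greenIntegral] at hχ0
      rw [hχ0]
      ring
    have hvol : ∀ k ∈ F, ∫ y, (B k).indicator (fun _ : Space n => |K| * ((C + 1) / r k)) y =
        |K| * (C + 1) * (2 ^ n * V) * r k ^ ((n : ℝ) - 1) := by
      intro k hk
      have hrk := (hr k hk).1
      rw [integral_indicator Metric.isOpen_ball.measurableSet, setIntegral_const, smul_eq_mul,
        measureReal_def, Measure.addHaar_ball_of_pos volume _ (by positivity), ENNReal.toReal_mul,
        ENNReal.toReal_ofReal (by positivity), ← measureReal_def, finrank_euclideanSpace_fin,
        Real.rpow_sub_one hrk.ne', Real.rpow_natCast]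
      ring
    rw [hdiff, abs_neg]
    calc |∫ y in Ω \ S, ((fderiv ℝ χ y (W y) + χ y * divergence W y) - divergence W y)|
        ≤ ∫ y in Ω \ S, G y := norm_integral_le_of_norm_le hGint.integrableOn
          ((ae_restrict_iff' hU.measurableSet).2 (.of_forall hpt))
      _ ≤ ∫ y, G y := setIntegral_le_integral hGint (.of_forall hG0)
      _ = |K| * (C + 1) * (2 ^ n * V) * ∑ k ∈ F, r k ^ ((n : ℝ) - 1) := by
          rw [integral_finsetSum _ fun k _ => hBint k, Finset.sum_congr rfl hvol, Finset.mul_sum]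
      _ ≤ |K| * (C + 1) * (2 ^ n * V) * ε := by
          gcongr
  rw [← abs_nonpos_iff]
  refine le_of_forall_pos_le_add fun ε hε => ?_
  set A := |K| * (C + 1) * (2 ^ n * V)
  have hA : 0 ≤ A := by positivity
  refine (key (ε / (A + 1)) (by positivity)).trans ?_
  rw [zero_add, mul_div_assoc', div_le_iff₀ (by positivity)]
  nlinarith

end DivergenceTheorem

/-! ### Regularity of time slices and of partial derivatives. -/

section Slices

variable {n : ℕ}

/-- A null set has dense complement. This carries closed conditions from `Ω \ S` to the closure of
`Ω`. -/
theorem closure_sdiff_eq_of_null {Ω S : Set (Space n)} (hΩ : IsOpen Ω) (hS : volume S = 0) :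
    closure (Ω \ S) = closure Ω := by
  refine subset_antisymm (closure_mono sdiff_subset) (closure_minimal ?_ isClosed_closure)
  have : Dense Sᶜ := interior_eq_empty_iff_dense_compl.1
    (Measure.interior_eq_empty_of_null hS)
  exact this.open_subset_closure_inter hΩ

variable {f : ℝ → Space n → ℝ} {T : ℝ} {U : Set (Space n)}

theorem contDiffAt_slice {k : ℕ}
    (hf : ContDiffOn ℝ k (fun p : ℝ × Space n => f p.1 p.2) (Ioo 0 T ×ˢ U)) (hU : IsOpen U) {t : ℝ}
    (ht : t ∈ Ioo 0 T) {x : Space n} (hx : x ∈ U) : ContDiffAt ℝ k (f t) x := by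
  have h1 : ContDiffAt ℝ k (fun p : ℝ × Space n => f p.1 p.2) (t, x) :=
    hf.contDiffAt ((isOpen_Ioo.prod hU).mem_nhds ⟨ht, hx⟩)
  exact h1.comp x (contDiffAt_const.prodMk contDiffAt_id)

theorem hasFDerivAt_uncurry
    (hf : ContDiffOn ℝ 1 (fun p : ℝ × Space n => f p.1 p.2) (Ioo 0 T ×ˢ U)) (hU : IsOpen U)
    {p : ℝ × Space n} (hp : p ∈ Ioo 0 T ×ˢ U) :
    HasFDerivAt (fun p : ℝ × Space n => f p.1 p.2)
      (fderiv ℝ (fun p : ℝ × Space n => f p.1 p.2) p) p :=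
  ((hf.differentiableOn one_ne_zero).differentiableAt
    ((isOpen_Ioo.prod hU).mem_nhds hp)).hasFDerivAt

theorem hasDerivAt_time
    (hf : ContDiffOn ℝ 1 (fun p : ℝ × Space n => f p.1 p.2) (Ioo 0 T ×ˢ U)) (hU : IsOpen U)
    {p : ℝ × Space n} (hp : p ∈ Ioo 0 T ×ˢ U) :
    HasDerivAt (fun s => f s p.2) (fderiv ℝ (fun p : ℝ × Space n => f p.1 p.2) p (1, 0)) p.1 := by
  have h1 : HasDerivAt (fun s : ℝ => (s, p.2)) ((1 : ℝ), (0 : Space n)) p.1 :=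
    (hasDerivAt_id p.1).prodMk (hasDerivAt_const _ _)
  exact (hasFDerivAt_uncurry hf hU hp).comp_hasDerivAt p.1 h1

theorem continuousOn_deriv_time
    (hf : ContDiffOn ℝ 1 (fun p : ℝ × Space n => f p.1 p.2) (Ioo 0 T ×ˢ U)) (hU : IsOpen U) :
    ContinuousOn (fun p : ℝ × Space n => deriv (fun s => f s p.2) p.1) (Ioo 0 T ×ˢ U) := by
  have h1 := hf.continuousOn_fderiv_of_isOpen (isOpen_Ioo.prod hU) le_rfl
  exact (h1.clm_apply continuousOn_const).congr fun p hp => (hasDerivAt_time hf hU hp).deriv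

theorem continuousOn_gradient_space
    (hf : ContDiffOn ℝ 1 (fun p : ℝ × Space n => f p.1 p.2) (Ioo 0 T ×ˢ U)) (hU : IsOpen U) :
    ContinuousOn (fun p : ℝ × Space n => ∇ (f p.1) p.2) (Ioo 0 T ×ˢ U) := by
  have h1 := hf.continuousOn_fderiv_of_isOpen (isOpen_Ioo.prod hU) le_rfl
  have h2 : ContinuousOn (fun p : ℝ × Space n =>
      (InnerProductSpace.toDual ℝ (Space n)).symm
        ((fderiv ℝ (fun p : ℝ × Space n => f p.1 p.2) p).comp
          (ContinuousLinearMap.inr ℝ ℝ (Space n)))) (Ioo 0 T ×ˢ U) :=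
    (InnerProductSpace.toDual ℝ (Space n)).symm.continuous.comp_continuousOn
      (h1.clm_comp continuousOn_const)
  refine h2.congr fun p hp => ?_
  have h3 : HasFDerivAt (fun y : Space n => (p.1, y)) (ContinuousLinearMap.inr ℝ ℝ (Space n)) p.2 :=
    (hasFDerivAt_const _ _).prodMk (hasFDerivAt_id _)
  have h4 : HasFDerivAt (f p.1) ((fderiv ℝ (fun p : ℝ × Space n => f p.1 p.2) p).comp
      (ContinuousLinearMap.inr ℝ ℝ (Space n))) p.2 :=
    HasFDerivAt.comp (f := fun y : Space n => (p.1, y)) (g := fun p : ℝ × Space n => f p.1 p.2) p.2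
      (hasFDerivAt_uncurry hf hU hp) h3
  simp only [gradient, h4.fderiv]

theorem continuousOn_slice {Y : Type*} [TopologicalSpace Y] {F : ℝ × Space n → Y} {I : Set ℝ}
    (hF : ContinuousOn F (I ×ˢ U)) {t : ℝ} (ht : t ∈ I) : ContinuousOn (fun x => F (t, x)) U :=
  hF.comp (by fun_prop) fun _ hx => ⟨ht, hx⟩

theorem contDiffOn_gradient {h : Space n → ℝ} (hU : IsOpen U) (hh : ContDiffOn ℝ 2 h U) :
    ContDiffOn ℝ 1 (∇ h) U :=
  (InnerProductSpace.toDual ℝ (Space n)).symm.toContinuousLinearEquiv.contDiff.comp_contDiffOn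
    (hh.fderiv_of_isOpen hU (by norm_num))

end Slices

/-! ### From one-sided normal derivatives to limits of the interior gradient. -/

section NormalDerivative

variable {n : ℕ}

/-- Along `ν` the defining function has derivative `c > 0` at its zero, so it is negative just
behind the boundary point. -/
theorem IsOuterUnitNormal.eventually_mem {Ω : Set (Space n)} {x ν : Space n}
    (hν : IsOuterUnitNormal Ω x ν) : ∀ᶠ s : ℝ in 𝓝[<] 0, x + s • ν ∈ Ω := by
  obtain ⟨hν1, g, c, hg, hgx, hc, hgrad, hloc⟩ := hν
  have hl : HasDerivAt (fun s : ℝ => x + s • ν) ν 0 := by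
    simpa using ((hasDerivAt_id (0 : ℝ)).smul_const ν).const_add x
  have hx0 : x + (0 : ℝ) • ν = x := by simp
  have hd : HasDerivAt (fun s : ℝ => g (x + s • ν)) c 0 := by
    have h1 : HasFDerivAt g (fderiv ℝ g x) (x + (0 : ℝ) • ν) := by
      rw [hx0]; exact (hg.differentiableAt one_ne_zero).hasFDerivAt
    have h2 := h1.comp_hasDerivAt (0 : ℝ) hl
    have h3 : fderiv ℝ g x ν = c := by
      rw [← inner_gradient_left, hgrad, real_inner_smul_left, real_inner_self_eq_norm_sq, hν1]
      simp
    rwa [h3] at h2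
  have h1 := (hasDerivAt_iff_tendsto_slope.1 hd).eventually_const_lt hc
  have h2 : ∀ᶠ s : ℝ in 𝓝 0, (x + s • ν ∈ Ω ↔ g (x + s • ν) < 0) := by
    have := hl.continuousAt.tendsto
    rw [hx0] at this
    exact this.eventually hloc
  filter_upwards [h1.filter_mono (nhdsWithin_mono _ fun s (hs : s < 0) => hs.ne),
    h2.filter_mono nhdsWithin_le_nhds, self_mem_nhdsWithin] with s hs1 hs2 hs3
  rw [hs2]
  simp only [slope_def_field, hx0, hgx, sub_zero] at hs1
  have hs3' : s < 0 := hs3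
  by_contra h
  exact absurd hs1 (not_lt.2 (div_nonpos_of_nonneg_of_nonpos (not_lt.1 h) hs3'.le))

/-- `C¹` regularity up to the boundary supplies a derivative continuous at `x`. It agrees with the
gradient inside, and its value on `ν` is `m` because the inner normal segment stays in the set where
it is a derivative. -/
theorem HasNormalDeriv.tendsto_inner_gradient {Ω S : Set (Space n)} (hΩ : IsOpen Ω)
    (hS : IsClosed S) {h : Space n → ℝ} (hh : ContDiffOn ℝ 1 h (closure Ω \ S)) {x ν : Space n}
    {m : ℝ} (hx : x ∈ frontier Ω \ S) (hν : IsOuterUnitNormal Ω x ν) (hm : HasNormalDeriv h m x ν) :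
    Filter.Tendsto (fun y => inner ℝ (∇ h y) ν) (𝓝[Ω \ S] x) (𝓝 m) := by
  have hxA : x ∈ closure Ω \ S := ⟨frontier_subset_closure hx.1, hx.2⟩
  have h1 := hh x hxA
  rw [show (1 : WithTop ℕ∞) = 0 + 1 from (zero_add 1).symm,
    contDiffWithinAt_succ_iff_hasFDerivWithinAt (by simp)] at h1
  obtain ⟨V, hV, -, h', hd, hc⟩ := h1
  rw [insert_eq_of_mem hxA] at hV
  obtain ⟨O, hO, hxO, hOV⟩ := mem_nhdsWithin.1 hV
  have hxV : x ∈ V := hOV ⟨hxO, hxA⟩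
  have hsub : Ω \ S ⊆ closure Ω \ S := sdiff_subset_sdiff_left subset_closure
  have hlim : Filter.Tendsto (fun y => h' y ν) (𝓝[Ω \ S] x) (𝓝 (h' x ν)) := by
    have h2 : Filter.Tendsto h' (𝓝[Ω \ S] x) (𝓝 (h' x)) :=
      hc.continuousWithinAt.tendsto.mono_left
        (nhdsWithin_le_of_mem (nhdsWithin_mono x hsub hV))
    exact ((ContinuousLinearMap.apply ℝ ℝ ν).continuous.tendsto (h' x)).comp h2
  have hm' : h' x ν = m := by
    have hl : HasDerivWithinAt (fun s : ℝ => x + s • ν) ν (Iic 0) 0 := by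
      have : HasDerivAt (fun s : ℝ => x + s • ν) ν 0 := by
        simpa using ((hasDerivAt_id (0 : ℝ)).smul_const ν).const_add x
      exact this.hasDerivWithinAt
    have hx0 : x + (0 : ℝ) • ν = x := by simp
    have hmem : ∀ᶠ s : ℝ in 𝓝[Iic 0] 0, x + s • ν ∈ V := by
      have hcont : Filter.Tendsto (fun s : ℝ => x + s • ν) (𝓝 0) (𝓝 x) := by
        have : ContinuousAt (fun s : ℝ => x + s • ν) 0 := by fun_prop
        simpa [ContinuousAt] using this
      have e1 := (hcont.eventually ((hO.inter hS.isOpen_compl).mem_nhds ⟨hxO, hx.2⟩)).filter_mono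
        (nhdsWithin_le_nhds (s := Iio (0 : ℝ)))
      rw [← Iio_union_right, nhdsWithin_union, Filter.eventually_sup]
      refine ⟨?_, ?_⟩
      · filter_upwards [e1, hν.eventually_mem] with s hs1 hs2
        exact hOV ⟨hs1.1, subset_closure hs2, hs1.2⟩
      · rw [nhdsWithin_singleton]
        simpa using hxV
    have hdx : HasFDerivWithinAt h (h' x) V (x + (0 : ℝ) • ν) := by rw [hx0]; exact hd x hxV
    set J : Set ℝ := Iic 0 ∩ {s | x + s • ν ∈ V}
    have h3 : HasDerivWithinAt (fun s : ℝ => h (x + s • ν)) (h' x ν) J 0 :=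
      hdx.comp_hasDerivWithinAt (0 : ℝ) (hl.mono inter_subset_left) fun s hs => hs.2
    have h4 : HasDerivWithinAt (fun s : ℝ => h (x + s • ν)) (h' x ν) (Iic 0) 0 :=
      h3.mono_of_mem_nhdsWithin (Filter.inter_mem self_mem_nhdsWithin hmem)
    exact (uniqueDiffWithinAt_Iic (0 : ℝ)).eq_deriv _ h4 hm
  rw [hm'] at hlim
  refine hlim.congr' ?_
  filter_upwards [inter_mem_nhdsWithin (Ω \ S) (hO.mem_nhds hxO)] with y hy
  have hVy : V ∈ 𝓝 y := by
    filter_upwards [(hO.inter (hΩ.sdiff hS)).mem_nhds ⟨hy.2, hy.1⟩] with z hz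
      using hOV ⟨hz.1, hsub hz.2⟩
  rw [inner_gradient_left, ((hd y (mem_of_mem_nhds hVy)).hasFDerivAt hVy).fderiv]

end NormalDerivative

/-! ### A priori bounds, weak formulation and differentiation under the integral. -/

section Solution

variable {n : ℕ} {Ω Γd Γn S : Set (Space n)} {T : ℝ} {u ρ : ℝ → Space n → ℝ}

theorem IsDirichletNeumannDomain.volume_exc (hD : IsDirichletNeumannDomain Ω Γd Γn S) :
    volume S = 0 :=
  volume_eq_zero_of_hausdorffMeasure_eq_zero hD.exc_null

theorem IsDirichletNeumannDomain.isOpen_sdiff (hD : IsDirichletNeumannDomain Ω Γd Γn S) :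
    IsOpen (Ω \ S) :=
  hD.isOpen.sdiff hD.isClosed_exc

theorem IsDirichletNeumannDomain.sdiff_ae_eq (hD : IsDirichletNeumannDomain Ω Γd Γn S) :
    (Ω \ S : Set (Space n)) =ᵐ[volume] Ω :=
  sdiff_null_ae_eq_self hD.volume_exc

theorem IsDirichletNeumannDomain.integrableOn_of_bound (hD : IsDirichletNeumannDomain Ω Γd Γn S)
    {f : Space n → ℝ} {M : ℝ} (hf : ContinuousOn f (Ω \ S)) (hM : ∀ x ∈ Ω \ S, |f x| ≤ M) :
    IntegrableOn f Ω := by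
  refine IntegrableOn.congr_set_ae ?_ hD.sdiff_ae_eq.symm
  have : IsFiniteMeasure (volume.restrict (Ω \ S)) := isFiniteMeasure_restrict.2
    (hD.isBounded.subset sdiff_subset).measure_lt_top.ne
  exact Integrable.of_bound (C := M) (hf.aestronglyMeasurable hD.isOpen_sdiff.measurableSet)
    ((ae_restrict_iff' hD.isOpen_sdiff.measurableSet).2 (.of_forall hM))

/-- Integrals over `Ω` are insensitive to the exceptional set. -/
theorem IsDirichletNeumannDomain.ae_restrict (hD : IsDirichletNeumannDomain Ω Γd Γn S)
    {p : Space n → Prop} (h : ∀ x ∈ Ω \ S, p x) : ∀ᵐ x ∂volume.restrict Ω, p x := by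
  rw [← Measure.restrict_congr_set hD.sdiff_ae_eq]
  exact (ae_restrict_iff' hD.isOpen_sdiff.measurableSet).2 (.of_forall h)

/-- The eikonal equation turns the bound on `Du` into `|1 - ρ| ≥ δ` off `S`, and continuity extends
this to the closed cylinder. A density starting below `1` would have to take the value `1` in order
to exceed it. -/
theorem IsHughesSolution.exists_bounds (hD : IsDirichletNeumannDomain Ω Γd Γn S) (hT : 0 < T)
    (hs : IsHughesSolution 1 Ω Γd Γn S T u ρ) (h0 : ∀ x ∈ Ω, 0 < ρ 0 x ∧ ρ 0 x < 1) :
    ∃ m δ K : ℝ, 0 < δ ∧ (∀ t ∈ Icc 0 T, ∀ x ∈ closure Ω, ρ t x ∈ Icc m (1 - δ)) ∧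
      ∀ t ∈ Ioo 0 T, ∀ x ∈ Ω \ S,
        |deriv (fun s => ρ s x) t| ≤ K ∧ ‖∇ (ρ t) x‖ ≤ K ∧ ‖∇ (u t) x‖ ≤ K := by
  obtain ⟨K, hK⟩ := hs.bounded_derivatives
  have hcl : closure (Ioo 0 T ×ˢ (Ω \ S)) = Icc 0 T ×ˢ closure Ω := by
    rw [closure_prod_eq, closure_Ioo hT.ne, closure_sdiff_eq_of_null hD.isOpen hD.volume_exc]
  -- The added `1` keeps the inverse meaningful whatever the sign or size of `K`.
  set δ : ℝ := (|K| + 1)⁻¹ with hδ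
  have hδ0 : 0 < δ := by positivity
  have hsq : ∀ p ∈ Icc 0 T ×ˢ closure Ω, δ ^ 2 ≤ (1 - ρ p.1 p.2) ^ 2 := by
    intro p hp
    rw [← hcl] at hp
    refine le_on_closure (f := fun _ => δ ^ 2) (g := fun p : ℝ × Space n => (1 - ρ p.1 p.2) ^ 2)
      ?_ continuousOn_const ?_ hp
    · rintro ⟨t, x⟩ ⟨ht, hx⟩
      obtain ⟨h1, h2⟩ := hs.eikonal t ht x hx
      have h3 : 0 < (1 - ρ t x) ^ 2 := by
        have : 1 - ρ t x ≠ 0 := sub_ne_zero.2 h1.symm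
        positivity
      have h4 : 1 / (1 - ρ t x) ^ 2 ≤ (|K| + 1) ^ 2 := by
        rw [← h2]
        have := (hK t ht x hx).2.2
        have h5 : ‖∇ (u t) x‖ ≤ |K| + 1 := by linarith [le_abs_self K]
        gcongr
      rw [div_le_iff₀ h3] at h4
      simp only [hδ, inv_pow]
      rw [inv_le_iff_one_le_mul₀ (by positivity)]
      linarith
    · rw [hcl]
      exact (continuousOn_const.sub hs.continuous_ρ).pow 2
  have hlt : ∀ t ∈ Icc 0 T, ∀ x ∈ Ω, ρ t x < 1 := by
    intro t ht x hx
    by_contra hcon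
    have hc : ContinuousOn (fun s => ρ s x) (Icc 0 t) :=
      hs.continuous_ρ.comp (f := fun s : ℝ => (s, x)) (by fun_prop)
        fun s hs' => ⟨⟨hs'.1, hs'.2.trans ht.2⟩, subset_closure hx⟩
    obtain ⟨s, hs', hs1⟩ := intermediate_value_Icc ht.1 hc ⟨(h0 x hx).2.le, not_lt.1 hcon⟩
    have := hsq (s, x) ⟨⟨hs'.1, hs'.2.trans ht.2⟩, subset_closure hx⟩
    simp only at hs1 this
    rw [hs1, sub_self] at this
    have : 0 < δ ^ 2 := by positivity
    linarith
  have hle : ∀ t ∈ Icc 0 T, ∀ x ∈ closure Ω, ρ t x ≤ 1 - δ := by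
    intro t ht x hx
    refine le_on_closure (f := ρ t) (g := fun _ => 1 - δ) (fun y hy => ?_)
      (continuousOn_slice hs.continuous_ρ ht) continuousOn_const hx
    have h1 := hsq (t, y) ⟨ht, subset_closure hy⟩
    have h2 := hlt t ht y hy
    have := (sq_le_sq₀ hδ0.le (by linarith : 0 ≤ 1 - ρ t y)).1 h1
    linarith
  have hcomp : IsCompact (Icc 0 T ×ˢ closure Ω) := isCompact_Icc.prod hD.isBounded.isCompact_closure
  obtain ⟨M, hM⟩ := hcomp.exists_bound_of_continuousOn hs.continuous_ρ
  exact ⟨-M, δ, K, hδ0, fun t ht x hx => ⟨(abs_le.1 (hM (t, x) ⟨ht, hx⟩)).1, hle t ht x hx⟩, hK⟩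

theorem exists_bound_Icc_of_continuousOn_Iio {G : ℝ → ℝ} (hG : ContinuousOn G (Iio 1)) {m δ : ℝ}
    (hδ : 0 < δ) : ∃ M, 0 ≤ M ∧ ∀ s ∈ Icc m (1 - δ), |G s| ≤ M := by
  obtain ⟨M, hM⟩ := isCompact_Icc.exists_bound_of_continuousOn
    (hG.mono fun s (hs : s ∈ Icc m (1 - δ)) => show s < 1 by linarith [hs.2])
  exact ⟨|M|, abs_nonneg M, fun s hs => (hM s hs).trans (le_abs_self M)⟩

/-- The (negative of the) flux of the density. -/
noncomputable def flux (u ρ : ℝ → Space n → ℝ) (t : ℝ) (x : Space n) : Space n :=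
  ∇ (ρ t) x + (ρ t x * (1 - ρ t x) ^ 2) • ∇ (u t) x

theorem IsHughesSolution.contDiffOn_ρ (hD : IsDirichletNeumannDomain Ω Γd Γn S)
    (hs : IsHughesSolution 1 Ω Γd Γn S T u ρ) {t : ℝ} (ht : t ∈ Ioo 0 T) :
    ContDiffOn ℝ 2 (ρ t) (Ω \ S) := fun _ hx =>
  (contDiffAt_slice (k := 2) hs.smooth_ρ.1 hD.isOpen_sdiff ht hx).contDiffWithinAt

theorem IsHughesSolution.contDiffOn_u (hD : IsDirichletNeumannDomain Ω Γd Γn S)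
    (hs : IsHughesSolution 1 Ω Γd Γn S T u ρ) {t : ℝ} (ht : t ∈ Ioo 0 T) :
    ContDiffOn ℝ 2 (u t) (Ω \ S) := fun _ hx =>
  (contDiffAt_slice (k := 2) hs.smooth_u.1 hD.isOpen_sdiff ht hx).contDiffWithinAt

theorem IsHughesSolution.contDiffOn_flux (hD : IsDirichletNeumannDomain Ω Γd Γn S)
    (hs : IsHughesSolution 1 Ω Γd Γn S T u ρ) {t : ℝ} (ht : t ∈ Ioo 0 T) :
    ContDiffOn ℝ 1 (flux u ρ t) (Ω \ S) := by
  have h1 : ContDiffOn ℝ 1 (ρ t) (Ω \ S) := (hs.contDiffOn_ρ hD ht).of_le (by norm_num)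
  exact (contDiffOn_gradient hD.isOpen_sdiff (hs.contDiffOn_ρ hD ht)).add
    ((h1.mul ((contDiffOn_const.sub h1).pow 2)).smul
      (contDiffOn_gradient hD.isOpen_sdiff (hs.contDiffOn_u hD ht)))

theorem IsHughesSolution.divergence_flux (hD : IsDirichletNeumannDomain Ω Γd Γn S)
    (hs : IsHughesSolution 1 Ω Γd Γn S T u ρ) {t : ℝ} (ht : t ∈ Ioo 0 T) {x : Space n}
    (hx : x ∈ Ω \ S) : divergence (flux u ρ t) x = deriv (fun s => ρ s x) t := by
  have hn := hD.isOpen_sdiff.mem_nhds hx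
  have h1 : ContDiffOn ℝ 1 (ρ t) (Ω \ S) := (hs.contDiffOn_ρ hD ht).of_le (by norm_num)
  have d1 : DifferentiableAt ℝ (∇ (ρ t)) x :=
    ((contDiffOn_gradient hD.isOpen_sdiff (hs.contDiffOn_ρ hD ht)).contDiffAt hn).differentiableAt
      one_ne_zero
  have d2 : DifferentiableAt ℝ (fun y => (ρ t y * (1 - ρ t y) ^ 2) • ∇ (u t) y) x :=
    (((h1.mul ((contDiffOn_const.sub h1).pow 2)).smul
      (contDiffOn_gradient hD.isOpen_sdiff (hs.contDiffOn_u hD ht))).contDiffAt hn).differentiableAt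
      one_ne_zero
  have h2 := hs.fokker_planck t ht x hx
  have h3 := divergence_add d1 d2
  rw [divergence_gradient ((hs.contDiffOn_ρ hD ht).contDiffAt hn)] at h3
  change divergence (fun y => ∇ (ρ t) y + (ρ t y * (1 - ρ t y) ^ 2) • ∇ (u t) y) x = _
  rw [h3]
  linarith

theorem IsHughesSolution.tendsto_inner_flux (hD : IsDirichletNeumannDomain Ω Γd Γn S)
    (hs : IsHughesSolution 1 Ω Γd Γn S T u ρ) {t : ℝ} (ht : t ∈ Ioo 0 T) {x ν : Space n}
    (hx : x ∈ frontier Ω \ S) (hxn : x ∈ Γn) (hν : IsOuterUnitNormal Ω x ν) :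
    Filter.Tendsto (fun y => inner ℝ (flux u ρ t y) ν) (𝓝[Ω \ S] x) (𝓝 0) := by
  have slice : ∀ f : ℝ → Space n → ℝ,
      ContDiffOn ℝ 1 (fun p : ℝ × Space n => f p.1 p.2) (Ioo 0 T ×ˢ (closure Ω \ S)) →
      ContDiffOn ℝ 1 (f t) (closure Ω \ S) := fun f hf =>
    hf.comp (contDiff_const.prodMk contDiff_id).contDiffOn fun y hy => ⟨ht, hy⟩
  obtain ⟨n1, n2⟩ := hs.neumann t ht x ⟨hxn, hx.2⟩ ν hν
  have l1 := n1.tendsto_inner_gradient hD.isOpen hD.isClosed_exc (slice ρ hs.smooth_ρ.2) hx hν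
  have l2 := n2.tendsto_inner_gradient hD.isOpen hD.isClosed_exc (slice u hs.smooth_u.2) hx hν
  have hc : Filter.Tendsto (ρ t) (𝓝[Ω \ S] x) (𝓝 (ρ t x)) :=
    ((continuousOn_slice hs.continuous_ρ (Ioo_subset_Icc_self ht)) x
      (frontier_subset_closure hx.1)).mono_left
      (nhdsWithin_mono x (sdiff_subset.trans subset_closure))
  have l3 := l1.add ((hc.mul ((hc.const_sub 1).pow 2)).mul l2)
  rw [mul_zero, add_zero] at l3
  refine l3.congr fun y => ?_
  rw [flux, inner_add_left, real_inner_smul_left]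

/-- The weak formulation of the Fokker-Planck equation, tested with `G(ρ)`. -/
theorem IsHughesSolution.integral_mul_deriv_eq (hD : IsDirichletNeumannDomain Ω Γd Γn S)
    (hT : 0 < T) (hs : IsHughesSolution 1 Ω Γd Γn S T u ρ)
    (h0 : ∀ x ∈ Ω, 0 < ρ 0 x ∧ ρ 0 x < 1) {G : ℝ → ℝ} (hG : ContDiffOn ℝ 1 G (Iio 1))
    (hG0 : G 0 = 0) {t : ℝ} (ht : t ∈ Ioo 0 T) :
    IntegrableOn (fun x => G (ρ t x) * deriv (fun s => ρ s x) t) Ω ∧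
    IntegrableOn (fun x => deriv G (ρ t x) * inner ℝ (∇ (ρ t) x) (flux u ρ t x)) Ω ∧
    ∫ x in Ω, G (ρ t x) * deriv (fun s => ρ s x) t =
      -∫ x in Ω, deriv G (ρ t x) * inner ℝ (∇ (ρ t) x) (flux u ρ t x) := by
  obtain ⟨m, δ, K, hδ, hρ, hK⟩ := hs.exists_bounds hD hT h0
  have ht' := Ioo_subset_Icc_self ht
  have hU := hD.isOpen_sdiff
  have hlt : ∀ x ∈ closure Ω, ρ t x < 1 := fun x hx => by linarith [(hρ t ht' x hx).2]
  have hUc : Ω \ S ⊆ closure Ω := sdiff_subset.trans subset_closure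
  have h1 : ContDiffOn ℝ 1 (ρ t) (Ω \ S) := (hs.contDiffOn_ρ hD ht).of_le (by norm_num)
  have hGd : ContinuousOn (deriv G) (Iio 1) := hG.continuousOn_deriv_of_isOpen isOpen_Iio le_rfl
  have hmaps : MapsTo (ρ t) (Ω \ S) (Iio 1) := fun x hx => hlt x (hUc hx)
  obtain ⟨M, hM0, hM⟩ := exists_bound_Icc_of_continuousOn_Iio hG.continuousOn (m := m) hδ
  obtain ⟨M', hM'0, hM'⟩ := exists_bound_Icc_of_continuousOn_Iio hGd (m := m) hδ
  obtain ⟨A, hA0, hA⟩ := exists_bound_Icc_of_continuousOn_Iio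
    (G := fun s => s * (1 - s) ^ 2) (by fun_prop) (m := m) hδ
  have hFb : ∀ x ∈ Ω \ S, ‖flux u ρ t x‖ ≤ |K| + A * |K| := by
    intro x hx
    obtain ⟨-, k1, k2⟩ := hK t ht x hx
    refine (norm_add_le _ _).trans (add_le_add (k1.trans (le_abs_self K)) ?_)
    rw [norm_smul]
    exact mul_le_mul (hA _ (hρ t ht' x (hUc hx))) (k2.trans (le_abs_self K)) (norm_nonneg _) hA0
  have hGρ : ContDiffOn ℝ 1 (fun x => G (ρ t x)) (Ω \ S) := hG.comp h1 hmaps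
  have hF := hs.contDiffOn_flux hD ht
  have hcderiv : ContinuousOn (fun x => deriv (fun s => ρ s x) t) (Ω \ S) :=
    continuousOn_slice (continuousOn_deriv_time (hs.smooth_ρ.1.of_le (by norm_num)) hU) ht
  have hcgrad : ContinuousOn (∇ (ρ t)) (Ω \ S) :=
    (contDiffOn_gradient hU (hs.contDiffOn_ρ hD ht)).continuousOn
  have b1 : ∀ x ∈ Ω \ S, |G (ρ t x) * deriv (fun s => ρ s x) t| ≤ M * |K| := by
    intro x hx
    rw [abs_mul]
    exact mul_le_mul (hM _ (hρ t ht' x (hUc hx))) ((hK t ht x hx).1.trans (le_abs_self K))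
      (abs_nonneg _) hM0
  have b2 : ∀ x ∈ Ω \ S, |deriv G (ρ t x) * inner ℝ (∇ (ρ t) x) (flux u ρ t x)| ≤
      M' * (|K| * (|K| + A * |K|)) := by
    intro x hx
    rw [abs_mul]
    refine mul_le_mul (hM' _ (hρ t ht' x (hUc hx))) ?_ (abs_nonneg _) hM'0
    exact (abs_real_inner_le_norm _ _).trans (mul_le_mul
      ((hK t ht x hx).2.1.trans (le_abs_self K)) (hFb x hx) (norm_nonneg _) (abs_nonneg _))
  have i1 : IntegrableOn (fun x => G (ρ t x) * deriv (fun s => ρ s x) t) Ω :=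
    hD.integrableOn_of_bound (hGρ.continuousOn.mul hcderiv) b1
  have i2 : IntegrableOn (fun x => deriv G (ρ t x) * inner ℝ (∇ (ρ t) x) (flux u ρ t x)) Ω :=
    hD.integrableOn_of_bound ((hGd.comp h1.continuousOn hmaps).mul (hcgrad.inner hF.continuousOn)) b2
  refine ⟨i1, i2, ?_⟩
  have hdiv : ∀ x ∈ Ω \ S, divergence (fun y => G (ρ t y) • flux u ρ t y) x =
      deriv G (ρ t x) * inner ℝ (∇ (ρ t) x) (flux u ρ t x) +
        G (ρ t x) * deriv (fun s => ρ s x) t := by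
    intro x hx
    have hn := hU.mem_nhds hx
    rw [divergence_smul ((hGρ.contDiffAt hn).differentiableAt one_ne_zero)
      ((hF.contDiffAt hn).differentiableAt one_ne_zero), hs.divergence_flux hD ht hx]
    congr 1
    have g1 : HasDerivAt G (deriv G (ρ t x)) (ρ t x) :=
      ((hG.contDiffAt (isOpen_Iio.mem_nhds (hmaps hx))).differentiableAt one_ne_zero).hasDerivAt
    have g2 := g1.comp_hasFDerivAt x
      ((h1.contDiffAt hn).differentiableAt one_ne_zero).hasFDerivAt
    have g3 : fderiv ℝ (fun y => G (ρ t y)) x = deriv G (ρ t x) • fderiv ℝ (ρ t) x := g2.fderiv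
    rw [g3, inner_gradient_left]
    rfl
  -- A single constant must bound the field and its divergence, so the two bounds are added.
  have hW : IsTangentialField Ω S (fun y => G (ρ t y) • flux u ρ t y)
      (M * (|K| + A * |K|) + (M' * (|K| * (|K| + A * |K|)) + M * |K|)) := by
    refine ⟨hGρ.smul hF, fun x hx => ?_, fun x hx => ?_, fun x hx ν hν => ?_⟩
    · have : ‖G (ρ t x) • flux u ρ t x‖ ≤ M * (|K| + A * |K|) := by
        rw [norm_smul]
        exact mul_le_mul (hM _ (hρ t ht' x (hUc hx))) (hFb x hx) (norm_nonneg _) hM0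
      have h3 : 0 ≤ M' * (|K| * (|K| + A * |K|)) + M * |K| := by positivity
      linarith
    · rw [hdiv x hx]
      have h3 : 0 ≤ M * (|K| + A * |K|) := by positivity
      have := (abs_add_le _ _).trans (add_le_add (b2 x hx) (b1 x hx))
      linarith
    · have hxc : x ∈ closure Ω := frontier_subset_closure hx.1
      simp only [real_inner_smul_left]
      have hmem : x ∈ Γd ∪ Γn := hD.frontier_eq ▸ hx.1
      rcases hmem with hxd | hxn
      -- On `Γd` the factor `G(ρ)` tends to `G 0 = 0` while the flux is merely bounded; on `Γn` the
      -- roles are exchanged.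
      · have hc : Filter.Tendsto (fun y => G (ρ t y)) (𝓝[Ω \ S] x) (𝓝 0) := by
          have c1 : Filter.Tendsto (ρ t) (𝓝[Ω \ S] x) (𝓝 (ρ t x)) :=
            ((continuousOn_slice hs.continuous_ρ ht') x hxc).mono_left (nhdsWithin_mono x hUc)
          have c2 := (hG.continuousOn.continuousAt (isOpen_Iio.mem_nhds (hlt x hxc))).tendsto.comp c1
          rwa [(hs.dirichlet t ht x hxd).1, hG0] at c2
        refine squeeze_zero_norm' (a := fun y => |G (ρ t y)| * ((|K| + A * |K|) * ‖ν‖)) ?_ ?_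
        · filter_upwards [self_mem_nhdsWithin] with y hy
          rw [norm_mul]
          refine mul_le_mul_of_nonneg_left ((abs_real_inner_le_norm _ _).trans ?_) (norm_nonneg _)
          exact mul_le_mul_of_nonneg_right (hFb y hy) (norm_nonneg _)
        · simpa using hc.abs.mul_const ((|K| + A * |K|) * ‖ν‖)
      · refine squeeze_zero_norm' (a := fun y => M * |inner ℝ (flux u ρ t y) ν|) ?_ ?_
        · filter_upwards [self_mem_nhdsWithin] with y hy
          rw [norm_mul]
          exact mul_le_mul_of_nonneg_right (hM _ (hρ t ht' y (hUc hy))) (norm_nonneg _)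
        · simpa using (hs.tendsto_inner_flux hD ht hx hxn hν).abs.const_mul M
  have hzero := hW.integral_divergence_eq_zero hD.isOpen hD.isBounded hD.isClosed_exc hD.exc_null
    hD.exists_normal
  rw [integral_congr_ae (hD.ae_restrict hdiv), integral_add i2 i1] at hzero
  linarith

/-- Differentiation of `∫_Ω H(ρ)` in time. -/
theorem IsHughesSolution.hasDerivAt_integral (hD : IsDirichletNeumannDomain Ω Γd Γn S)
    (hT : 0 < T) (hs : IsHughesSolution 1 Ω Γd Γn S T u ρ)
    (h0 : ∀ x ∈ Ω, 0 < ρ 0 x ∧ ρ 0 x < 1) {H : ℝ → ℝ} (hH : ContDiffOn ℝ 1 H (Iio 1))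
    {t : ℝ} (ht : t ∈ Ioo 0 T) :
    HasDerivAt (fun s => ∫ x in Ω, H (ρ s x))
      (∫ x in Ω, deriv H (ρ t x) * deriv (fun s => ρ s x) t) t := by
  obtain ⟨m, δ, K, hδ, hρ, hK⟩ := hs.exists_bounds hD hT h0
  have hU := hD.isOpen_sdiff
  have hUc : Ω \ S ⊆ closure Ω := sdiff_subset.trans subset_closure
  have hlt : ∀ t ∈ Icc 0 T, ∀ x ∈ closure Ω, ρ t x < 1 := fun t ht x hx => by
    linarith [(hρ t ht x hx).2]
  have hHd : ContinuousOn (deriv H) (Iio 1) := hH.continuousOn_deriv_of_isOpen isOpen_Iio le_rfl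
  obtain ⟨M', hM'0, hM'⟩ := exists_bound_Icc_of_continuousOn_Iio hHd (m := m) hδ
  obtain ⟨M, hM0, hM⟩ := exists_bound_Icc_of_continuousOn_Iio hH.continuousOn (m := m) hδ
  have hc : ∀ s ∈ Ioo 0 T, ContinuousOn (fun x => H (ρ s x)) (Ω \ S) := fun s hs' =>
    hH.continuousOn.comp (hs.contDiffOn_ρ hD hs').continuousOn
      fun x hx => hlt s (Ioo_subset_Icc_self hs') x (hUc hx)
  have hi : ∀ s ∈ Ioo 0 T, IntegrableOn (fun x => H (ρ s x)) Ω := fun s hs' =>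
    hD.integrableOn_of_bound (hc s hs')
      fun x hx => hM _ (hρ s (Ioo_subset_Icc_self hs') x (hUc hx))
  have hcd : ContinuousOn (fun x => deriv H (ρ t x) * deriv (fun s => ρ s x) t) (Ω \ S) :=
    (hHd.comp (hs.contDiffOn_ρ hD ht).continuousOn
      fun x hx => hlt t (Ioo_subset_Icc_self ht) x (hUc hx)).mul
    (continuousOn_slice (continuousOn_deriv_time (hs.smooth_ρ.1.of_le (by norm_num)) hU) ht)
  have hbd : ∀ s ∈ Ioo 0 T, ∀ x ∈ Ω \ S,
      |deriv H (ρ s x) * deriv (fun s => ρ s x) s| ≤ M' * |K| := by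
    intro s hs' x hx
    rw [abs_mul]
    exact mul_le_mul (hM' _ (hρ s (Ioo_subset_Icc_self hs') x (hUc hx)))
      ((hK s hs' x hx).1.trans (le_abs_self K)) (abs_nonneg _) hM'0
  have hfin : IsFiniteMeasure (volume.restrict Ω) :=
    isFiniteMeasure_restrict.2 hD.isBounded.measure_lt_top.ne
  refine (hasDerivAt_integral_of_dominated_loc_of_deriv_le (Ioo_mem_nhds ht.1 ht.2)
    (F := fun s x => H (ρ s x)) (F' := fun s x => deriv H (ρ s x) * deriv (fun s => ρ s x) s)
    (bound := fun _ => M' * |K|) ?_ (hi t ht)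
    (hD.integrableOn_of_bound hcd (hbd t ht)).aestronglyMeasurable ?_ (integrable_const _) ?_).2
  · filter_upwards [Ioo_mem_nhds ht.1 ht.2] with s hs' using (hi s hs').aestronglyMeasurable
  · exact hD.ae_restrict fun x hx s hs' => hbd s hs' x hx
  · refine hD.ae_restrict fun x hx s hs' => ?_
    have g1 : HasDerivAt H (deriv H (ρ s x)) (ρ s x) :=
      ((hH.contDiffAt (isOpen_Iio.mem_nhds (hlt s (Ioo_subset_Icc_self hs') x
        (hUc hx)))).differentiableAt one_ne_zero).hasDerivAt
    have g2 := hasDerivAt_time (p := (s, x)) (hs.smooth_ρ.1.of_le (by norm_num)) hU ⟨hs', hx⟩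
    have g3 : HasDerivAt (fun s => ρ s x) (deriv (fun s => ρ s x) s) s :=
      g2.differentiableAt.hasDerivAt
    exact g1.comp s g3

theorem IsHughesSolution.integrableOn_comp (hD : IsDirichletNeumannDomain Ω Γd Γn S)
    (hT : 0 < T) (hs : IsHughesSolution 1 Ω Γd Γn S T u ρ)
    (h0 : ∀ x ∈ Ω, 0 < ρ 0 x ∧ ρ 0 x < 1) {H : ℝ → ℝ} (hH : ContinuousOn H (Iio 1))
    {t : ℝ} (ht : t ∈ Icc 0 T) : IntegrableOn (fun x => H (ρ t x)) Ω := by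
  obtain ⟨m, δ, K, hδ, hρ, hK⟩ := hs.exists_bounds hD hT h0
  obtain ⟨M, hM0, hM⟩ := exists_bound_Icc_of_continuousOn_Iio hH (m := m) hδ
  have hUc : Ω \ S ⊆ closure Ω := sdiff_subset.trans subset_closure
  refine hD.integrableOn_of_bound (hH.comp
    ((continuousOn_slice hs.continuous_ρ ht).mono hUc) fun x hx => ?_)
    fun x hx => hM _ (hρ t ht x (hUc hx))
  have := (hρ t ht x (hUc hx)).2
  exact show ρ t x < 1 by linarith

theorem IsHughesSolution.continuousOn_integral (hD : IsDirichletNeumannDomain Ω Γd Γn S)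
    (hT : 0 < T) (hs : IsHughesSolution 1 Ω Γd Γn S T u ρ)
    (h0 : ∀ x ∈ Ω, 0 < ρ 0 x ∧ ρ 0 x < 1) {H : ℝ → ℝ} (hH : ContinuousOn H (Iio 1)) :
    ContinuousOn (fun s => ∫ x in Ω, H (ρ s x)) (Icc 0 T) := by
  obtain ⟨m, δ, K, hδ, hρ, hK⟩ := hs.exists_bounds hD hT h0
  obtain ⟨M, hM0, hM⟩ := exists_bound_Icc_of_continuousOn_Iio hH (m := m) hδ
  have hfin : IsFiniteMeasure (volume.restrict Ω) :=
    isFiniteMeasure_restrict.2 hD.isBounded.measure_lt_top.ne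
  refine continuousOn_of_dominated (bound := fun _ => M)
    (fun t ht => (hs.integrableOn_comp hD hT h0 hH ht).aestronglyMeasurable)
    (fun t ht => (ae_restrict_iff' hD.isOpen.measurableSet).2 (.of_forall fun x hx =>
      hM _ (hρ t ht x (subset_closure hx)))) (integrable_const _) ?_
  refine (ae_restrict_iff' hD.isOpen.measurableSet).2 (.of_forall fun x hx => ?_)
  refine hH.comp (hs.continuous_ρ.comp (f := fun s : ℝ => (s, x)) (by fun_prop)
    fun s hs' => ⟨hs', subset_closure hx⟩) fun t ht => ?_
  have := (hρ t ht x (subset_closure hx)).2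
  exact show ρ t x < 1 by linarith

end Solution

/-! ### Gronwall's inequality, nonnegativity of the density and decay of mass. -/

section Estimates

/-- Gronwall: the product with `exp (-C t)` has nonpositive derivative inside the interval and is
continuous up to the endpoints. -/
theorem le_exp_mul_of_deriv_le {f f' : ℝ → ℝ} {T C : ℝ} (hf : ContinuousOn f (Icc 0 T))
    (hd : ∀ t ∈ Ioo 0 T, HasDerivAt f (f' t) t) (hle : ∀ t ∈ Ioo 0 T, f' t ≤ C * f t)
    {t : ℝ} (ht : t ∈ Icc 0 T) : f t ≤ Real.exp (C * t) * f 0 := by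
  have hder : ∀ s ∈ Ioo 0 T, HasDerivAt (fun s => Real.exp (-(C * s)) * f s)
      (Real.exp (-(C * s)) * -(C * 1) * f s + Real.exp (-(C * s)) * f' s) s := fun s hs =>
    ((((hasDerivAt_id s).const_mul C).neg).exp).mul (hd s hs)
  have hanti : AntitoneOn (fun s => Real.exp (-(C * s)) * f s) (Icc 0 T) := by
    refine antitoneOn_of_deriv_nonpos (convex_Icc 0 T) (ContinuousOn.mul (by fun_prop) hf) ?_ ?_
    · rw [interior_Icc]
      exact fun s hs => (hder s hs).differentiableAt.differentiableWithinAt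
    · rw [interior_Icc]
      intro s hs
      rw [(hder s hs).deriv]
      have h1 := mul_nonneg (Real.exp_pos (-(C * s))).le (sub_nonneg.2 (hle s hs))
      nlinarith
  have h1 := hanti (left_mem_Icc.2 (ht.1.trans ht.2)) ht ht.1
  simp only [mul_zero, neg_zero, Real.exp_zero, one_mul] at h1
  calc f t = Real.exp (C * t) * (Real.exp (-(C * t)) * f t) := by
        rw [← mul_assoc, ← Real.exp_add, add_neg_cancel, Real.exp_zero, one_mul]
    _ ≤ Real.exp (C * t) * f 0 := by gcongr

theorem hasDerivAt_mul_abs (s : ℝ) : HasDerivAt (fun s : ℝ => s * |s|) (2 * |s|) s := by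
  rcases lt_trichotomy s 0 with hs | rfl | hs
  · have h := (hasDerivAt_id s).mul (hasDerivAt_abs_neg hs)
    refine HasDerivAt.congr_deriv h ?_
    rw [abs_of_neg hs]; simp; ring
  · rw [hasDerivAt_iff_tendsto_slope_zero]
    have h : Filter.Tendsto (fun t : ℝ => |t|) (𝓝[≠] 0) (𝓝 (2 * |0|)) := by
      have := (continuous_abs.tendsto (0 : ℝ)).mono_left (nhdsWithin_le_nhds (s := {0}ᶜ))
      simpa using this
    refine h.congr' ?_
    filter_upwards [self_mem_nhdsWithin] with t ht
    have ht' : t ≠ 0 := ht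
    simp [ht']
  · have h := (hasDerivAt_id s).mul (hasDerivAt_abs_pos hs)
    refine HasDerivAt.congr_deriv h ?_
    rw [abs_of_pos hs]; simp; ring

/-- `2 (s⁻)³`. -/
noncomputable def negPartCube (s : ℝ) : ℝ := s * (s * |s|) - s ^ 3

theorem hasDerivAt_negPartCube (s : ℝ) :
    HasDerivAt negPartCube (3 * (s * |s|) - 3 * s ^ 2) s := by
  have h := ((hasDerivAt_id s).mul (hasDerivAt_mul_abs s)).sub (hasDerivAt_pow 3 s)
  refine HasDerivAt.congr_deriv h ?_
  simp; ring

theorem deriv_negPartCube : deriv negPartCube = fun s => 3 * (s * |s|) - 3 * s ^ 2 :=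
  funext fun s => (hasDerivAt_negPartCube s).deriv

theorem hasDerivAt_deriv_negPartCube (s : ℝ) :
    HasDerivAt (deriv negPartCube) (6 * (|s| - s)) s := by
  rw [deriv_negPartCube]
  have h := ((hasDerivAt_mul_abs s).const_mul 3).sub ((hasDerivAt_pow 2 s).const_mul 3)
  refine HasDerivAt.congr_deriv h ?_
  simp; ring

theorem contDiff_negPartCube : ContDiff ℝ 1 negPartCube := by
  refine contDiff_one_iff_deriv.2 ⟨fun s => (hasDerivAt_negPartCube s).differentiableAt, ?_⟩
  exact Differentiable.continuous fun s => (hasDerivAt_deriv_negPartCube s).differentiableAt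

/-- The reason for the third power: the derivative serves as a test function and must itself be
`C¹`, which fails for the square of the negative part. -/
theorem contDiff_deriv_negPartCube : ContDiff ℝ 1 (deriv negPartCube) := by
  refine contDiff_one_iff_deriv.2 ⟨fun s => (hasDerivAt_deriv_negPartCube s).differentiableAt, ?_⟩
  rw [funext fun s => (hasDerivAt_deriv_negPartCube s).deriv]
  fun_prop

theorem negPartCube_eq (s : ℝ) : negPartCube s = s ^ 2 * (|s| - s) := by
  unfold negPartCube; ring

theorem negPartCube_nonneg (s : ℝ) : 0 ≤ negPartCube s := by
  rw [negPartCube_eq]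
  exact mul_nonneg (sq_nonneg s) (sub_nonneg.2 (le_abs_self s))

theorem contDiffOn_one_sub_rpow (p : ℝ) : ContDiffOn ℝ 1 (fun s : ℝ => (1 - s) ^ p) (Iio 1) :=
  (contDiff_const.sub contDiff_id).contDiffOn.rpow_const_of_ne
    fun s (hs : s < 1) => by simp only [id]; linarith

theorem hasDerivAt_one_sub_rpow (p : ℝ) {s : ℝ} (hs : s < 1) :
    HasDerivAt (fun s : ℝ => (1 - s) ^ p) (-p * (1 - s) ^ (p - 1)) s := by
  have h := ((hasDerivAt_id s).const_sub 1).rpow_const (p := p)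
    (.inl (by simp only [id]; linarith))
  refine HasDerivAt.congr_deriv h ?_
  simp

variable {n : ℕ} {Ω Γd Γn S : Set (Space n)} {T : ℝ} {u ρ : ℝ → Space n → ℝ}

theorem IsHughesSolution.lt_one (hD : IsDirichletNeumannDomain Ω Γd Γn S) (hT : 0 < T)
    (hs : IsHughesSolution 1 Ω Γd Γn S T u ρ) (h0 : ∀ x ∈ Ω, 0 < ρ 0 x ∧ ρ 0 x < 1)
    {t : ℝ} (ht : t ∈ Icc 0 T) {x : Space n} (hx : x ∈ closure Ω) : ρ t x < 1 := by
  obtain ⟨m, δ, K, hδ, hρ, -⟩ := hs.exists_bounds hD hT h0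
  linarith [(hρ t ht x hx).2]

/-- By the eikonal equation one of the two factors `1 - ρ` in the mobility cancels against `|Du|`.
The absolute value of `ρ` stays because the bound is also used to prove `ρ ≥ 0`. -/
theorem IsHughesSolution.neg_inner_flux_le (hD : IsDirichletNeumannDomain Ω Γd Γn S) (hT : 0 < T)
    (hs : IsHughesSolution 1 Ω Γd Γn S T u ρ) (h0 : ∀ x ∈ Ω, 0 < ρ 0 x ∧ ρ 0 x < 1)
    {t : ℝ} (ht : t ∈ Ioo 0 T) {x : Space n} (hx : x ∈ Ω \ S) :
    -inner ℝ (∇ (ρ t) x) (flux u ρ t x) ≤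
      -‖∇ (ρ t) x‖ ^ 2 + |ρ t x| * (1 - ρ t x) * ‖∇ (ρ t) x‖ := by
  have h1 : 0 < 1 - ρ t x := by
    linarith [hs.lt_one hD hT h0 (Ioo_subset_Icc_self ht) (subset_closure hx.1)]
  have h2 : ‖∇ (u t) x‖ = 1 / (1 - ρ t x) := by
    rw [← sq_eq_sq₀ (norm_nonneg _) (by positivity), (hs.eikonal t ht x hx).2, div_pow, one_pow]
  have h3 : |ρ t x * (1 - ρ t x) ^ 2 * inner ℝ (∇ (ρ t) x) (∇ (u t) x)| ≤
      |ρ t x| * (1 - ρ t x) * ‖∇ (ρ t) x‖ := by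
    rw [abs_mul, abs_mul, abs_of_nonneg (sq_nonneg (1 - ρ t x))]
    have h4 := abs_real_inner_le_norm (∇ (ρ t) x) (∇ (u t) x)
    rw [h2] at h4
    calc |ρ t x| * (1 - ρ t x) ^ 2 * |inner ℝ (∇ (ρ t) x) (∇ (u t) x)|
        ≤ |ρ t x| * (1 - ρ t x) ^ 2 * (‖∇ (ρ t) x‖ * (1 / (1 - ρ t x))) := by gcongr
      _ = |ρ t x| * (1 - ρ t x) * ‖∇ (ρ t) x‖ := by field_simp
  rw [flux, inner_add_right, real_inner_self_eq_norm_sq, inner_smul_right]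
  linarith [(abs_le.1 h3).1]

/-- With `H = negPartCube`, completing the square in `|Dρ|` leaves `H''(ρ) ρ²` times a constant,
which is again a multiple of `H(ρ)`. Gronwall from initial value zero gives `∫ H(ρ) = 0`, and
continuity removes the exceptional null set. -/
theorem IsHughesSolution.nonneg (hD : IsDirichletNeumannDomain Ω Γd Γn S) (hT : 0 < T)
    (hs : IsHughesSolution 1 Ω Γd Γn S T u ρ) (h0 : ∀ x ∈ Ω, 0 < ρ 0 x ∧ ρ 0 x < 1)
    {t : ℝ} (ht : t ∈ Icc 0 T) {x : Space n} (hx : x ∈ Ω) : 0 ≤ ρ t x := by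
  obtain ⟨m, δ, K, hδ, hρ, -⟩ := hs.exists_bounds hD hT h0
  -- Without a sign for `ρ`, `(1 - ρ)²` need not be at most `1`; any bound on it will do.
  obtain ⟨B, hB0, hB⟩ := exists_bound_Icc_of_continuousOn_Iio
    (G := fun s => (1 - s) ^ 2) (by fun_prop) (m := m) hδ
  have hH := contDiff_negPartCube.contDiffOn (s := Iio (1 : ℝ))
  have hG := contDiff_deriv_negPartCube.contDiffOn (s := Iio (1 : ℝ))
  have hG0 : deriv negPartCube 0 = 0 := by rw [deriv_negPartCube]; simp
  have hle : ∀ s ∈ Ioo 0 T, ∫ x in Ω, deriv negPartCube (ρ s x) * deriv (fun r => ρ r x) s ≤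
      (3 / 2 * B) * ∫ x in Ω, negPartCube (ρ s x) := by
    intro s hs'
    obtain ⟨-, i2, h⟩ := hs.integral_mul_deriv_eq hD hT h0 hG hG0 hs'
    rw [h, ← integral_neg, ← integral_const_mul]
    refine integral_mono_ae i2.neg ((hs.integrableOn_comp hD hT h0 hH.continuousOn
      (Ioo_subset_Icc_self hs')).const_mul _) (hD.ae_restrict fun x hx => ?_)
    have h1 := hs.neg_inner_flux_le hD hT h0 hs' hx
    have h2 := hB _ (hρ s (Ioo_subset_Icc_self hs') x (subset_closure hx.1))
    rw [abs_of_nonneg (sq_nonneg _)] at h2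
    simp only [(hasDerivAt_deriv_negPartCube (ρ s x)).deriv]
    set r := ρ s x
    set a := ‖∇ (ρ s) x‖
    have h3 : 0 ≤ |r| - r := sub_nonneg.2 (le_abs_self r)
    have h4 : -a ^ 2 + |r| * (1 - r) * a ≤ r ^ 2 * B / 4 := by
      have e1 : r ^ 2 * (1 - r) ^ 2 ≤ r ^ 2 * B := mul_le_mul_of_nonneg_left h2 (sq_nonneg r)
      have e2 : (|r| * (1 - r)) ^ 2 = r ^ 2 * (1 - r) ^ 2 := by rw [mul_pow, sq_abs]
      nlinarith [sq_nonneg (a - |r| * (1 - r) / 2)]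
    rw [negPartCube_eq]
    calc -(6 * (|r| - r) * inner ℝ (∇ (ρ s) x) (flux u ρ s x))
        = 6 * (|r| - r) * -inner ℝ (∇ (ρ s) x) (flux u ρ s x) := by ring
      _ ≤ 6 * (|r| - r) * (r ^ 2 * B / 4) := by
          gcongr
          exact h1.trans h4
      _ = 3 / 2 * B * (r ^ 2 * (|r| - r)) := by ring
  have hgr := le_exp_mul_of_deriv_le (hs.continuousOn_integral hD hT h0 hH.continuousOn)
    (fun s hs' => hs.hasDerivAt_integral hD hT h0 hH hs') hle ht
  have hinit : ∫ x in Ω, negPartCube (ρ 0 x) = 0 :=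
    setIntegral_eq_zero_of_forall_eq_zero fun x hx => by
      rw [negPartCube_eq, abs_of_pos (h0 x hx).1, sub_self, mul_zero]
  rw [hinit, mul_zero] at hgr
  have hzero : ∫ x in Ω, negPartCube (ρ t x) = 0 :=
    le_antisymm hgr (integral_nonneg fun _ => negPartCube_nonneg _)
  rw [integral_eq_zero_iff_of_nonneg (fun _ => negPartCube_nonneg _)
    (hs.integrableOn_comp hD hT h0 hH.continuousOn ht)] at hzero
  have heq := Measure.eqOn_open_of_ae_eq hzero hD.isOpen
    (contDiff_negPartCube.continuous.comp_continuousOn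
      ((continuousOn_slice hs.continuous_ρ ht).mono subset_closure)) continuousOn_const hx
  simp only [Pi.zero_apply, negPartCube_eq] at heq
  by_contra hneg
  rw [not_le] at hneg
  rw [abs_of_neg hneg] at heq
  have : 0 < ρ t x ^ 2 * (-ρ t x - ρ t x) :=
    mul_pos (sq_pos_of_neg hneg) (by linarith)
  linarith

/-- The total mass does not increase. -/
theorem IsHughesSolution.integral_deriv_nonpos (hD : IsDirichletNeumannDomain Ω Γd Γn S)
    (hT : 0 < T) (hs : IsHughesSolution 1 Ω Γd Γn S T u ρ)
    (h0 : ∀ x ∈ Ω, 0 < ρ 0 x ∧ ρ 0 x < 1) {t : ℝ} (ht : t ∈ Ioo 0 T) :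
    IntegrableOn (fun x => deriv (fun s => ρ s x) t) Ω ∧
      ∫ x in Ω, deriv (fun s => ρ s x) t ≤ 0 := by
  obtain ⟨m, δ, K, hδ, hρ, hK⟩ := hs.exists_bounds hD hT h0
  have ht' := Ioo_subset_Icc_self ht
  have hint : IntegrableOn (fun x => deriv (fun s => ρ s x) t) Ω := hD.integrableOn_of_bound
    (continuousOn_slice (continuousOn_deriv_time (hs.smooth_ρ.1.of_le (by norm_num))
      hD.isOpen_sdiff) ht) fun x hx => (hK t ht x hx).1
  refine ⟨hint, ?_⟩
  have hfin : IsFiniteMeasure (volume.restrict Ω) :=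
    isFiniteMeasure_restrict.2 hD.isBounded.measure_lt_top.ne
  have hG : ∀ k : ℕ, ContDiff ℝ 1 fun s : ℝ => 1 - Real.exp (-(k * s)) := fun k => by fun_prop
  have hGd : ∀ (k : ℕ) (s : ℝ), deriv (fun s : ℝ => 1 - Real.exp (-(k * s))) s =
      k * Real.exp (-(k * s)) := fun k s => by
    have h := (((hasDerivAt_id s).const_mul (k : ℝ)).neg.exp).const_sub 1
    refine h.deriv.trans ?_
    simp
    ring
  have hnn : ∀ x ∈ Ω \ S, 0 ≤ ρ t x := fun x hx => hs.nonneg hD hT h0 ht' hx.1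
  have hlt : ∀ x ∈ Ω \ S, ρ t x < 1 := fun x hx => hs.lt_one hD hT h0 ht' (subset_closure hx.1)
  -- With `r = k ρ` this is the dominating bound for the right-hand side, which tends to zero
  -- pointwise.
  have hexp : ∀ r : ℝ, 0 ≤ r → r * Real.exp (-r) ≤ 1 := fun r hr => by
    rw [Real.exp_neg, ← div_eq_mul_inv, div_le_one (Real.exp_pos r)]
    linarith [Real.add_one_le_exp r]
  have hR : ∀ k : ℕ, ContinuousOn (fun s : ℝ => |K| * (k * s * Real.exp (-(k * s)))) (Iio 1) :=
    fun k => by fun_prop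
  have hle : ∀ k : ℕ, ∫ x in Ω, (1 - Real.exp (-(k * ρ t x))) * deriv (fun s => ρ s x) t ≤
      ∫ x in Ω, |K| * (k * ρ t x * Real.exp (-(k * ρ t x))) := by
    intro k
    obtain ⟨-, i2, h⟩ := hs.integral_mul_deriv_eq hD hT h0 (hG k).contDiffOn (by simp) ht
    rw [h, ← integral_neg]
    refine integral_mono_ae i2.neg (hs.integrableOn_comp hD hT h0 (hR k) ht')
      (hD.ae_restrict fun x hx => ?_)
    have h1 := hs.neg_inner_flux_le hD hT h0 ht hx
    have h2 : ‖∇ (ρ t) x‖ ≤ |K| := (hK t ht x hx).2.1.trans (le_abs_self K)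
    have h3 := hnn x hx
    have h4 := hlt x hx
    simp only [hGd]
    rw [abs_of_nonneg h3] at h1
    have h5 : -inner ℝ (∇ (ρ t) x) (flux u ρ t x) ≤ ρ t x * |K| := by
      have e1 : ρ t x * (1 - ρ t x) * ‖∇ (ρ t) x‖ ≤ ρ t x * 1 * |K| := by
        gcongr
        linarith
      nlinarith [sq_nonneg ‖∇ (ρ t) x‖]
    calc -(k * Real.exp (-(k * ρ t x)) * inner ℝ (∇ (ρ t) x) (flux u ρ t x))
        = k * Real.exp (-(k * ρ t x)) * -inner ℝ (∇ (ρ t) x) (flux u ρ t x) := by ring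
      _ ≤ k * Real.exp (-(k * ρ t x)) * (ρ t x * |K|) := by gcongr
      _ = |K| * (k * ρ t x * Real.exp (-(k * ρ t x))) := by ring
  have htop : ∀ x, 0 < ρ t x →
      Filter.Tendsto (fun k : ℕ => (k : ℝ) * ρ t x) Filter.atTop Filter.atTop := fun x hx =>
    tendsto_natCast_atTop_atTop.atTop_mul_const hx
  have hl1 : Filter.Tendsto
      (fun k : ℕ => ∫ x in Ω, (1 - Real.exp (-(k * ρ t x))) * deriv (fun s => ρ s x) t)
      Filter.atTop (𝓝 (∫ x in Ω, deriv (fun s => ρ s x) t)) := by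
    refine tendsto_integral_of_dominated_convergence (fun _ => |K|) (fun k =>
      (hs.integral_mul_deriv_eq hD hT h0 (hG k).contDiffOn (by simp) ht).1.aestronglyMeasurable)
      (integrable_const _) (fun k => hD.ae_restrict fun x hx => ?_)
      (hD.ae_restrict fun x hx => ?_)
    · have e1 : Real.exp (-(k * ρ t x)) ≤ 1 := by
        rw [Real.exp_le_one_iff]
        have := mul_nonneg (Nat.cast_nonneg (α := ℝ) k) (hnn x hx)
        linarith
      rw [norm_mul, Real.norm_of_nonneg (by linarith)]
      exact (mul_le_of_le_one_left (norm_nonneg _) (by linarith [Real.exp_pos (-(k * ρ t x))])).trans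
        ((hK t ht x hx).1.trans (le_abs_self K))
    · rcases (hnn x hx).eq_or_lt with h | h
      -- Where `ρ = 0` the test function is `0` for every `k`, not close to `1`; but there `ρ ≥ 0`
      -- makes `t` a minimum in time, so `ρ_t = 0` and the limit is still correct.
      · have hmin : IsLocalMin (fun s => ρ s x) t := by
          filter_upwards [Ioo_mem_nhds ht.1 ht.2] with s hs'
          rw [← h]
          exact hs.nonneg hD hT h0 (Ioo_subset_Icc_self hs') hx.1
        rw [hmin.deriv_eq_zero]
        simp
      · have := ((Real.tendsto_exp_neg_atTop_nhds_zero.comp (htop x h)).const_sub 1).mul_const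
          (deriv (fun s => ρ s x) t)
        simpa using this
  have hl2 : Filter.Tendsto
      (fun k : ℕ => ∫ x in Ω, |K| * (k * ρ t x * Real.exp (-(k * ρ t x)))) Filter.atTop (𝓝 0) := by
    have h := tendsto_integral_of_dominated_convergence (μ := volume.restrict Ω)
      (F := fun (k : ℕ) x => |K| * (k * ρ t x * Real.exp (-(k * ρ t x)))) (f := fun _ => (0 : ℝ))
      (fun _ => |K|) (fun k => (hs.integrableOn_comp hD hT h0 (hR k) ht').aestronglyMeasurable)
      (integrable_const _) (fun k => hD.ae_restrict fun x hx => ?_)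
      (hD.ae_restrict fun x hx => ?_)
    · simpa using h
    · have e0 : 0 ≤ k * ρ t x := mul_nonneg (Nat.cast_nonneg k) (hnn x hx)
      have e1 := hexp _ e0
      rw [Real.norm_of_nonneg (by positivity)]
      exact mul_le_of_le_one_right (abs_nonneg K) e1
    · rcases (hnn x hx).eq_or_lt with h | h
      · simp [← h]
      · have := ((Real.tendsto_pow_mul_exp_neg_atTop_nhds_zero 1).comp (htop x h)).const_mul |K|
        simpa using this
  exact le_of_tendsto_of_tendsto' hl1 hl2 hle

end Estimates

/-! ### The differential inequality for the congestion integral and its integrated form. -/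

section Congestion

variable {n : ℕ} {Ω Γd Γn S : Set (Space n)} {T : ℝ} {u ρ : ℝ → Space n → ℝ}

/-- Identifies the dissipation produced by the test function `(1-ρ)^α - 1` with the integrand of the
gradient estimate. -/
theorem IsHughesSolution.norm_gradient_rpow_sq (hD : IsDirichletNeumannDomain Ω Γd Γn S)
    (hT : 0 < T) (hs : IsHughesSolution 1 Ω Γd Γn S T u ρ)
    (h0 : ∀ x ∈ Ω, 0 < ρ 0 x ∧ ρ 0 x < 1) (α : ℝ) {t : ℝ} (ht : t ∈ Ioo 0 T) {x : Space n}
    (hx : x ∈ Ω \ S) :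
    ‖∇ (fun y => (1 - ρ t y) ^ ((α + 1) / 2)) x‖ ^ 2 =
      ((α + 1) / 2) ^ 2 * ((1 - ρ t x) ^ (α - 1) * ‖∇ (ρ t) x‖ ^ 2) := by
  have h1 : 0 < 1 - ρ t x := by
    linarith [hs.lt_one hD hT h0 (Ioo_subset_Icc_self ht) (subset_closure hx.1)]
  have hd : DifferentiableAt ℝ (ρ t) x :=
    ((hs.contDiffOn_ρ hD ht).contDiffAt (hD.isOpen_sdiff.mem_nhds hx)).differentiableAt two_ne_zero
  have h2 := (hasDerivAt_one_sub_rpow ((α + 1) / 2) (s := ρ t x) (by linarith)).comp_hasFDerivAt x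
    hd.hasFDerivAt
  have h3 : fderiv ℝ (fun y => (1 - ρ t y) ^ ((α + 1) / 2)) x =
      (-((α + 1) / 2) * (1 - ρ t x) ^ ((α + 1) / 2 - 1)) • fderiv ℝ (ρ t) x := h2.fderiv
  have h4 : ∇ (fun y => (1 - ρ t y) ^ ((α + 1) / 2)) x =
      (-((α + 1) / 2) * (1 - ρ t x) ^ ((α + 1) / 2 - 1)) • ∇ (ρ t) x := by
    simp only [gradient, h3, map_smul]
  have h5 : ((1 - ρ t x) ^ ((α + 1) / 2 - 1)) ^ 2 = (1 - ρ t x) ^ (α - 1) := by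
    rw [← Real.rpow_mul_natCast h1.le]
    congr 1
    push_cast
    ring
  rw [h4, norm_smul, mul_pow, Real.norm_eq_abs, sq_abs, mul_pow, h5]
  ring

theorem IsHughesSolution.hasDerivAt_congestion (hD : IsDirichletNeumannDomain Ω Γd Γn S)
    (hT : 0 < T) (hs : IsHughesSolution 1 Ω Γd Γn S T u ρ)
    (h0 : ∀ x ∈ Ω, 0 < ρ 0 x ∧ ρ 0 x < 1) (α : ℝ) {t : ℝ} (ht : t ∈ Ioo 0 T) :
    HasDerivAt (congestion Ω ρ α) (deriv (congestion Ω ρ α) t) t :=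
  (hs.hasDerivAt_integral hD hT h0 (contDiffOn_one_sub_rpow (α + 1)) ht).differentiableAt.hasDerivAt

theorem IsHughesSolution.exists_bound_rpow_mul_gradient (hD : IsDirichletNeumannDomain Ω Γd Γn S)
    (hT : 0 < T) (hs : IsHughesSolution 1 Ω Γd Γn S T u ρ)
    (h0 : ∀ x ∈ Ω, 0 < ρ 0 x ∧ ρ 0 x < 1) (p : ℝ) :
    ∃ M, ∀ t ∈ Ioo 0 T, ∀ x ∈ Ω \ S, |(1 - ρ t x) ^ p * ‖∇ (ρ t) x‖ ^ 2| ≤ M := by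
  obtain ⟨m, δ, K, hδ, hρ, hK⟩ := hs.exists_bounds hD hT h0
  obtain ⟨M, hM0, hM⟩ := exists_bound_Icc_of_continuousOn_Iio
    (contDiffOn_one_sub_rpow p).continuousOn (m := m) hδ
  refine ⟨M * |K| ^ 2, fun t ht x hx => ?_⟩
  rw [abs_mul, abs_of_nonneg (sq_nonneg ‖∇ (ρ t) x‖)]
  have h1 := hM _ (hρ t (Ioo_subset_Icc_self ht) x (subset_closure hx.1))
  have h2 : ‖∇ (ρ t) x‖ ≤ |K| := (hK t ht x hx).2.1.trans (le_abs_self K)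
  gcongr

theorem IsHughesSolution.continuousOn_rpow_mul_gradient
    (hD : IsDirichletNeumannDomain Ω Γd Γn S)
    (hT : 0 < T) (hs : IsHughesSolution 1 Ω Γd Γn S T u ρ)
    (h0 : ∀ x ∈ Ω, 0 < ρ 0 x ∧ ρ 0 x < 1) (p : ℝ) :
    ContinuousOn (fun q : ℝ × Space n => (1 - ρ q.1 q.2) ^ p * ‖∇ (ρ q.1) q.2‖ ^ 2)
      (Ioo 0 T ×ˢ (Ω \ S)) := by
  have h1 : ContinuousOn (fun q : ℝ × Space n => (1 - ρ q.1 q.2) ^ p) (Ioo 0 T ×ˢ (Ω \ S)) := by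
    refine (contDiffOn_one_sub_rpow p).continuousOn.comp (hs.continuous_ρ.mono
      (prod_mono Ioo_subset_Icc_self (sdiff_subset.trans subset_closure))) ?_
    rintro ⟨t, x⟩ ⟨ht, hx⟩
    exact hs.lt_one hD hT h0 (Ioo_subset_Icc_self ht) (subset_closure hx.1)
  exact h1.mul ((continuousOn_gradient_space (hs.smooth_ρ.1.of_le (by norm_num))
    hD.isOpen_sdiff).norm.pow 2)

/-- The differential inequality for the congestion integral, with the dissipation term. -/
theorem IsHughesSolution.deriv_congestion_add_le (hD : IsDirichletNeumannDomain Ω Γd Γn S)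
    (hT : 0 < T) (hs : IsHughesSolution 1 Ω Γd Γn S T u ρ)
    (h0 : ∀ x ∈ Ω, 0 < ρ 0 x ∧ ρ 0 x < 1) {α : ℝ} (hα : α < -1) {t : ℝ} (ht : t ∈ Ioo 0 T) :
    deriv (congestion Ω ρ α) t + 2 * α / (α + 1) *
        ∫ x in Ω, ‖∇ (fun y => (1 - ρ t y) ^ ((α + 1) / 2)) x‖ ^ 2 ≤
      α * (α + 1) / 2 * congestion Ω ρ α t := by
  have ht' := Ioo_subset_Icc_self ht
  have hα1 : α + 1 ≠ 0 := by linarith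
  have hβ : 0 < α * (α + 1) := mul_pos_of_neg_of_neg (by linarith) (by linarith)
  obtain ⟨hi, hmass⟩ := hs.integral_deriv_nonpos hD hT h0 ht
  have hlt : ∀ x ∈ Ω \ S, ρ t x < 1 := fun x hx => hs.lt_one hD hT h0 ht' (subset_closure hx.1)
  set D : Space n → ℝ := fun x => (1 - ρ t x) ^ (α - 1) * ‖∇ (ρ t) x‖ ^ 2 with hDdef
  have hDi : IntegrableOn D Ω := by
    obtain ⟨M, hM⟩ := hs.exists_bound_rpow_mul_gradient hD hT h0 (α - 1)
    exact hD.integrableOn_of_bound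
      (continuousOn_slice (hs.continuousOn_rpow_mul_gradient hD hT h0 (α - 1)) ht) (hM t ht)
  have hdiss : ∫ x in Ω, ‖∇ (fun y => (1 - ρ t y) ^ ((α + 1) / 2)) x‖ ^ 2 =
      ((α + 1) / 2) ^ 2 * ∫ x in Ω, D x := by
    rw [← integral_const_mul]
    exact integral_congr_ae (hD.ae_restrict fun x hx => hs.norm_gradient_rpow_sq hD hT h0 α ht hx)
  -- Subtracting `1` gives `G 0 = 0`, as the Dirichlet part of the boundary requires; the price is
  -- the mass term.
  set G : ℝ → ℝ := fun s => (1 - s) ^ α - 1 with hG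
  have hGd : ∀ s < 1, deriv G s = -α * (1 - s) ^ (α - 1) := fun s hs1 =>
    ((hasDerivAt_one_sub_rpow α hs1).sub_const 1).deriv
  obtain ⟨i1, i2, hweak⟩ := hs.integral_mul_deriv_eq hD hT h0 (G := G)
    ((contDiffOn_one_sub_rpow α).sub contDiffOn_const) (by simp [hG]) ht
  have hderiv : deriv (congestion Ω ρ α) t =
      -(α + 1) * (∫ x in Ω, G (ρ t x) * deriv (fun s => ρ s x) t) +
        -(α + 1) * ∫ x in Ω, deriv (fun s => ρ s x) t := by
    have h := (hs.hasDerivAt_integral hD hT h0 (contDiffOn_one_sub_rpow (α + 1)) ht).deriv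
    rw [← mul_add, ← integral_add i1 hi, ← integral_const_mul]
    refine h.trans (integral_congr_ae (hD.ae_restrict fun x hx => ?_))
    simp only [(hasDerivAt_one_sub_rpow (α + 1) (hlt x hx)).deriv, add_sub_cancel_right, hG]
    ring
  have hcong : IntegrableOn (fun x => (1 - ρ t x) ^ (α + 1)) Ω :=
    hs.integrableOn_comp hD hT h0 (contDiffOn_one_sub_rpow (α + 1)).continuousOn ht'
  have hmain : -(α + 1) * (∫ x in Ω, G (ρ t x) * deriv (fun s => ρ s x) t) ≤
      α * (α + 1) / 2 * congestion Ω ρ α t - α * (α + 1) / 2 * ∫ x in Ω, D x := by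
    rw [hweak, mul_neg, neg_mul, neg_neg, ← integral_const_mul, congestion, ← integral_const_mul,
      ← integral_const_mul, ← integral_sub (hcong.const_mul _) (hDi.const_mul _)]
    refine integral_mono_ae (i2.const_mul _) ((hcong.const_mul _).sub (hDi.const_mul _))
      (hD.ae_restrict fun x hx => ?_)
    have h1 := hs.neg_inner_flux_le hD hT h0 ht hx
    have h2 := hlt x hx
    have h3 := hs.nonneg hD hT h0 ht' hx.1
    simp only [hGd _ h2, hDdef]
    rw [abs_of_nonneg h3] at h1
    set r := ρ t x
    set a := ‖∇ (ρ t) x‖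
    have h4 : 0 < 1 - r := by linarith
    have h5 : (1 - r) ^ (α + 1) = (1 - r) ^ (α - 1) * (1 - r) ^ 2 := by
      rw [← Real.rpow_natCast (1 - r) 2, ← Real.rpow_add h4]
      congr 1
      push_cast
      ring
    -- Young's inequality after `r ≤ 1`: half of the dissipation absorbs the transport term, the
    -- other half survives.
    have h6 : r * (1 - r) * a ≤ a ^ 2 / 2 + (1 - r) ^ 2 / 2 := by
      have e1 : r * ((1 - r) * a) ≤ 1 * ((1 - r) * a) := by
        have : 0 ≤ (1 - r) * a := mul_nonneg h4.le (norm_nonneg _)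
        gcongr
      nlinarith [sq_nonneg (a - (1 - r))]
    have h7 : 0 < (1 - r) ^ (α - 1) := Real.rpow_pos_of_pos h4 _
    rw [h5]
    calc (α + 1) * (-α * (1 - r) ^ (α - 1) * inner ℝ (∇ (ρ t) x) (flux u ρ t x))
        = α * (α + 1) * (1 - r) ^ (α - 1) * -inner ℝ (∇ (ρ t) x) (flux u ρ t x) := by ring
      _ ≤ α * (α + 1) * (1 - r) ^ (α - 1) * (-a ^ 2 / 2 + (1 - r) ^ 2 / 2) := by
          gcongr
          linarith
      _ = α * (α + 1) / 2 * ((1 - r) ^ (α - 1) * (1 - r) ^ 2) -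
          α * (α + 1) / 2 * ((1 - r) ^ (α - 1) * a ^ 2) := by ring
  have hmass' : -(α + 1) * ∫ x in Ω, deriv (fun s => ρ s x) t ≤ 0 :=
    mul_nonpos_of_nonneg_of_nonpos (by linarith) hmass
  have hcoef : 2 * α / (α + 1) * (((α + 1) / 2) ^ 2 * ∫ x in Ω, D x) =
      α * (α + 1) / 2 * ∫ x in Ω, D x := by
    field_simp
  rw [hdiss, hcoef, hderiv]
  linarith

theorem IsHughesSolution.deriv_congestion_le (hD : IsDirichletNeumannDomain Ω Γd Γn S)
    (hT : 0 < T) (hs : IsHughesSolution 1 Ω Γd Γn S T u ρ)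
    (h0 : ∀ x ∈ Ω, 0 < ρ 0 x ∧ ρ 0 x < 1) {α : ℝ} (hα : α < -1) {t : ℝ} (ht : t ∈ Ioo 0 T) :
    deriv (congestion Ω ρ α) t ≤ α * (α + 1) / 2 * congestion Ω ρ α t := by
  have h1 := hs.deriv_congestion_add_le hD hT h0 hα ht
  have h2 : 0 ≤ 2 * α / (α + 1) := div_nonneg_of_nonpos (by linarith) (by linarith)
  have h3 : 0 ≤ ∫ x in Ω, ‖∇ (fun y => (1 - ρ t y) ^ ((α + 1) / 2)) x‖ ^ 2 :=
    integral_nonneg fun _ => sq_nonneg _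
  have := mul_nonneg h2 h3
  linarith

theorem IsHughesSolution.congestion_le (hD : IsDirichletNeumannDomain Ω Γd Γn S)
    (hT : 0 < T) (hs : IsHughesSolution 1 Ω Γd Γn S T u ρ)
    (h0 : ∀ x ∈ Ω, 0 < ρ 0 x ∧ ρ 0 x < 1) {α : ℝ} (hα : α < -1) {t : ℝ} (ht : t ∈ Icc 0 T) :
    congestion Ω ρ α t ≤ Real.exp (α * (α + 1) / 2 * t) * congestion Ω ρ α 0 :=
  le_exp_mul_of_deriv_le
    (hs.continuousOn_integral hD hT h0 (contDiffOn_one_sub_rpow (α + 1)).continuousOn)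
    (fun _ hs' => hs.hasDerivAt_congestion hD hT h0 α hs')
    (fun _ hs' => hs.deriv_congestion_le hD hT h0 hα hs') ht

theorem IsHughesSolution.congestion_nonneg (hD : IsDirichletNeumannDomain Ω Γd Γn S)
    (hT : 0 < T) (hs : IsHughesSolution 1 Ω Γd Γn S T u ρ)
    (h0 : ∀ x ∈ Ω, 0 < ρ 0 x ∧ ρ 0 x < 1) (α : ℝ) {t : ℝ} (ht : t ∈ Icc 0 T) :
    0 ≤ congestion Ω ρ α t :=
  setIntegral_nonneg hD.isOpen.measurableSet fun x hx =>
    Real.rpow_nonneg (by linarith [hs.lt_one hD hT h0 ht (subset_closure hx)]) _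

theorem IsHughesSolution.integrableOn_gradient_rpow (hD : IsDirichletNeumannDomain Ω Γd Γn S)
    (hT : 0 < T) (hs : IsHughesSolution 1 Ω Γd Γn S T u ρ)
    (h0 : ∀ x ∈ Ω, 0 < ρ 0 x ∧ ρ 0 x < 1) (α : ℝ) :
    IntegrableOn (fun p : ℝ × Space n =>
      ‖∇ (fun y => (1 - ρ p.1 y) ^ ((α + 1) / 2)) p.2‖ ^ 2) (Ioo 0 T ×ˢ Ω) := by
  have hopen : IsOpen (Ioo 0 T ×ˢ (Ω \ S)) := isOpen_Ioo.prod hD.isOpen_sdiff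
  have hae : (Ioo 0 T ×ˢ (Ω \ S) : Set (ℝ × Space n)) =ᵐ[volume] Ioo 0 T ×ˢ Ω :=
    Measure.set_prod_ae_eq (by rfl) hD.sdiff_ae_eq
  refine IntegrableOn.congr_set_ae ?_ hae.symm
  obtain ⟨M, hM⟩ := hs.exists_bound_rpow_mul_gradient hD hT h0 (α - 1)
  have hfin : IsFiniteMeasure (volume.restrict (Ioo 0 T ×ˢ (Ω \ S) : Set (ℝ × Space n))) :=
    isFiniteMeasure_restrict.2
      ((Metric.isBounded_Ioo 0 T).prod (hD.isBounded.subset sdiff_subset)).measure_lt_top.ne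
  have h1 : IntegrableOn (fun q : ℝ × Space n => ((α + 1) / 2) ^ 2 *
      ((1 - ρ q.1 q.2) ^ (α - 1) * ‖∇ (ρ q.1) q.2‖ ^ 2)) (Ioo 0 T ×ˢ (Ω \ S)) :=
    Integrable.const_mul (Integrable.of_bound (C := M)
      ((hs.continuousOn_rpow_mul_gradient hD hT h0 (α - 1)).aestronglyMeasurable
        hopen.measurableSet)
      ((ae_restrict_iff' hopen.measurableSet).2 (.of_forall fun q hq => hM q.1 hq.1 q.2 hq.2))) _
  exact h1.congr_fun (fun q hq => (hs.norm_gradient_rpow_sq hD hT h0 α hq.1 hq.2).symm)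
    hopen.measurableSet

theorem IsHughesSolution.integral_gradient_rpow_le (hD : IsDirichletNeumannDomain Ω Γd Γn S)
    (hT : 0 < T) (hs : IsHughesSolution 1 Ω Γd Γn S T u ρ)
    (h0 : ∀ x ∈ Ω, 0 < ρ 0 x ∧ ρ 0 x < 1) {α : ℝ} (hα : α < -1) {B : ℝ}
    (hB : ∀ t ∈ Icc 0 T, congestion Ω ρ α t ≤ B) :
    2 * α / (α + 1) *
        ∫ t in (0 : ℝ)..T, ∫ x in Ω, ‖∇ (fun y => (1 - ρ t y) ^ ((α + 1) / 2)) x‖ ^ 2 ≤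
      B + T * (α * (α + 1) / 2 * B) := by
  set D : ℝ → ℝ := fun t => ∫ x in Ω, ‖∇ (fun y => (1 - ρ t y) ^ ((α + 1) / 2)) x‖ ^ 2 with hDdef
  have hβ : 0 < α * (α + 1) := mul_pos_of_neg_of_neg (by linarith) (by linarith)
  have hDi : IntegrableOn D (Ioo 0 T) := by
    have h1 := hs.integrableOn_gradient_rpow hD hT h0 α
    rw [IntegrableOn, Measure.volume_eq_prod, ← Measure.prod_restrict] at h1
    exact h1.integral_prod_left
  have hDi' : IntegrableOn D (Icc 0 T) := by
    rwa [integrableOn_Icc_iff_integrableOn_Ioo]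
  have hDii : IntervalIntegrable D volume 0 T :=
    (intervalIntegrable_iff_integrableOn_Icc_of_le hT.le).2 hDi'
  have hφ : IntegrableOn (fun t => 2 * α / (α + 1) * D t - α * (α + 1) / 2 * B) (Icc 0 T) :=
    (hDi'.const_mul _).sub (integrableOn_const (by simp))
  -- This form of the fundamental theorem needs only an integrable lower bound for the derivative of
  -- the negated congestion integral, not integrability of that derivative.
  have h := intervalIntegral.integral_le_sub_of_hasDeriv_right_of_le hT.le
    (g := fun t => -congestion Ω ρ α t) (g' := fun t => -deriv (congestion Ω ρ α) t)
    (hs.continuousOn_integral hD hT h0 (contDiffOn_one_sub_rpow (α + 1)).continuousOn).neg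
    (fun t ht => (hs.hasDerivAt_congestion hD hT h0 α ht).neg.hasDerivWithinAt) hφ
    (fun t ht => by
      have h1 := hs.deriv_congestion_add_le hD hT h0 hα ht
      have h2 := mul_le_mul_of_nonneg_left (hB t (Ioo_subset_Icc_self ht)) (half_pos hβ).le
      linarith)
  rw [intervalIntegral.integral_sub (hDii.const_mul _) (by simp),
    intervalIntegral.integral_const_mul, intervalIntegral.integral_const, smul_eq_mul,
    sub_zero] at h
  have h1 := hB 0 (left_mem_Icc.2 hT.le)
  have h2 := hs.congestion_nonneg hD hT h0 α (right_mem_Icc.2 hT.le)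
  linarith

end Congestion

/-! ### The theorem, with explicit constants. -/

theorem proposition2 (α : ℝ) (hα : α < -1) :
    (∃ C : ℝ, ∀ (n : ℕ) (Ω Γd Γn S : Set (Space n)) (T : ℝ) (u ρ : ℝ → Space n → ℝ),
      0 < T →
      IsDirichletNeumannDomain Ω Γd Γn S →
      IsHughesSolution 1 Ω Γd Γn S T u ρ →
      (∀ x ∈ Ω, 0 < ρ 0 x ∧ ρ 0 x < 1) →
      (∀ t ∈ Icc 0 T, (∀ x ∈ Ω, ρ t x < 1) ∧
        IntegrableOn (fun x => (1 - ρ t x) ^ (α + 1)) Ω) ∧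
      ∀ t ∈ Ioo 0 T, DifferentiableAt ℝ (congestion Ω ρ α) t ∧
        deriv (congestion Ω ρ α) t ≤ C * congestion Ω ρ α t) ∧
    (∀ T M : ℝ, 0 < T →
      ∃ C : ℝ, ∀ (n : ℕ) (Ω Γd Γn S : Set (Space n)) (u ρ : ℝ → Space n → ℝ),
        IsDirichletNeumannDomain Ω Γd Γn S →
        IsHughesSolution 1 Ω Γd Γn S T u ρ →
        (∀ x ∈ Ω, 0 < ρ 0 x ∧ ρ 0 x < 1) →
        congestion Ω ρ α 0 ≤ M →
        (∀ t ∈ Icc 0 T, congestion Ω ρ α t ≤ C) ∧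
        IntegrableOn (fun p : ℝ × Space n =>
          ‖∇ (fun y => (1 - ρ p.1 y) ^ ((α + 1) / 2)) p.2‖ ^ 2) (Ioo 0 T ×ˢ Ω) ∧
        ∫ t in (0 : ℝ)..T, ∫ x in Ω, ‖∇ (fun y => (1 - ρ t y) ^ ((α + 1) / 2)) x‖ ^ 2 ≤ C) := by
  have hβ : 0 < α * (α + 1) := mul_pos_of_neg_of_neg (by linarith) (by linarith)
  have hκ : 0 < 2 * α / (α + 1) := div_pos_of_neg_of_neg (by linarith) (by linarith)
  refine ⟨⟨α * (α + 1) / 2, fun n Ω Γd Γn S T u ρ hT hD hs h0 => ⟨fun t ht =>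
    ⟨fun x hx => hs.lt_one hD hT h0 ht (subset_closure hx),
      hs.integrableOn_comp hD hT h0 (contDiffOn_one_sub_rpow (α + 1)).continuousOn ht⟩,
    fun t ht => ⟨(hs.hasDerivAt_congestion hD hT h0 α ht).differentiableAt,
      hs.deriv_congestion_le hD hT h0 hα ht⟩⟩⟩, fun T M hT => ?_⟩
  -- Gronwall's bound at the final time, with `M` in place of the initial congestion integral.
  set B := Real.exp (α * (α + 1) / 2 * T) * M with hBdef
  -- The second entry is the integrated dissipation inequality divided by the positive factor `2 * α
  -- / (α + 1)`.
  refine ⟨max B ((B + T * (α * (α + 1) / 2 * B)) / (2 * α / (α + 1))),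
    fun n Ω Γd Γn S u ρ hD hs h0 hM => ?_⟩
  have hB : ∀ t ∈ Icc 0 T, congestion Ω ρ α t ≤ B := fun t ht => by
    have h1 := hs.congestion_nonneg hD hT h0 α (left_mem_Icc.2 hT.le)
    refine (hs.congestion_le hD hT h0 hα ht).trans ?_
    have := ht.2
    rw [hBdef]
    gcongr
  refine ⟨fun t ht => (hB t ht).trans (le_max_left _ _),
    hs.integrableOn_gradient_rpow hD hT h0 α, le_trans ?_ (le_max_right _ _)⟩
  rw [le_div_iff₀ hκ, mul_comm]
  exact hs.integral_gradient_rpow_le hD hT h0 hα hB
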